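/- For a positive integer $n$ put $N=2^n$ and $V_N=([0,N-1]\cap\mathbb Z)^2$. For $k\ge 0$ let $\mathcal B_k$ be the collection of squares $B=c+([0,2^k-1]\cap\mathbb Z)^2$, $c\in\mathbb Z^2$, where $c$ is called the lower left corner of $B$; let $\mathcal B_k(z)$ be the collection of those $B\in\mathcal B_k$ that contain $z$, and let $\mathcal B_k^N$ be the collection of those whose lower left corner lies in $V_N$. Let $\{b_{k,B}\}_{k\ge 0,\,B\in\mathcal B_k^N}$ be independent centered Gaussian random variables, $b_{k,B}$ having variance $2^{-2k}$. For every $B\in\mathcal B_k$ set $b^N_{k,B}=b_{k,B'}$, where $B'\in\mathcal B_k^N$ is the unique translate of $B$ by an element of $(N\mathbb Z)^2$ whose lower left corner lies in $V_N$. For an integer $0\le k_0\le n$ define the modified branching random walk truncated at scale $k_0$ and its maximum by $$S_z^{N,k_0}=\sum_{k=k_0}^n\ \sum_{B\in\mathcal B_k(z)} b^N_{k,B}\quad(z\in V_N),\qquad S^*_{N,k_0}=\max_{z\in V_N}S_z^{N,k_0}.$$ **Proposition.** There is a function $f:\{0,1,2,\dots\}\to[0,\infty)$ such that, for every integer $k_0\ge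 0$ and every $N=2^n$ with $n\ge 1$ and $N\ge 2^{2k_0}$, the random variable $S^*_{N,k_0}$ is integrable and $$\mathbb E\,S^*_{N,k_0}\ \ge\ 2\sqrt{\log 2}\;n-\frac{3}{4\sqrt{\log 2}}\,\log n-f(k_0),$$ where $\log$ is the natural logarithm. -/

import Mathlib

open MeasureTheory ProbabilityTheory
open scoped NNReal

namespace MBRW

/-- The box `V_N = ([0, N - 1] ∩ ℤ)²` with `N = 2 ^ n`. -/
noncomputable def box (n : ℕ) : Finset (ℤ × ℤ) :=
  Finset.Icc 0 (2 ^ n - 1) ×ˢ Finset.Icc 0 (2 ^ n - 1)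

/-- The square of side `2 ^ k` (that is, with `2 ^ k` lattice points on each side) in `ℤ²` with
lower left corner `c`. A square of side `2 ^ k` is determined by its lower left corner, see
`square_injective`. -/
noncomputable def square (k : ℕ) (c : ℤ × ℤ) : Finset (ℤ × ℤ) :=
  Finset.Icc c.1 (c.1 + 2 ^ k - 1) ×ˢ Finset.Icc c.2 (c.2 + 2 ^ k - 1)

/-- The lower left corners of the squares of side `2 ^ k` which contain `z`. -/
noncomputable def cornersAt (k : ℕ) (z : ℤ × ℤ) : Finset (ℤ × ℤ) :=
  Finset.Icc (z.1 - 2 ^ k + 1) z.1 ×ˢ Finset.Icc (z.2 - 2 ^ k + 1) z.2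

theorem box_nonempty (n : ℕ) : (box n).Nonempty := by
  have h : (1 : ℤ) ≤ 2 ^ n := one_le_pow₀ (by norm_num)
  refine ⟨(0, 0), ?_⟩
  simp only [box, Finset.mem_product, Finset.mem_Icc]
  omega

theorem square_injective (k : ℕ) : Function.Injective (square k) := by
  have hk : (1 : ℤ) ≤ 2 ^ k := one_le_pow₀ (by norm_num)
  intro c d h
  have h1 : c ∈ square k d := by
    rw [← h]
    simp only [square, Finset.mem_product, Finset.mem_Icc]
    omega
  have h2 : d ∈ square k c := by
    rw [h]
    simp only [square, Finset.mem_product, Finset.mem_Icc]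
    omega
  simp only [square, Finset.mem_product, Finset.mem_Icc] at h1 h2
  ext <;> omega

theorem mem_cornersAt (k : ℕ) (z c : ℤ × ℤ) : c ∈ cornersAt k z ↔ z ∈ square k c := by
  simp only [cornersAt, square, Finset.mem_product, Finset.mem_Icc]
  omega

/-- The representative in `V_N` of a lattice point modulo `(N ℤ)²`, where `N = 2 ^ n`. -/
noncomputable def wrap (n : ℕ) (c : ℤ × ℤ) : box n :=
  ⟨(c.1 % 2 ^ n, c.2 % 2 ^ n), by
    have h : (0 : ℤ) < 2 ^ n := by positivity
    have h1 := Int.emod_nonneg c.1 h.ne'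
    have h2 := Int.emod_nonneg c.2 h.ne'
    have h3 := Int.emod_lt_of_pos c.1 h
    have h4 := Int.emod_lt_of_pos c.2 h
    simp only [box, Finset.mem_product, Finset.mem_Icc]
    omega⟩

/-- `wrap n c` is the unique point of `V_N` that differs from `c` by an element of `(N ℤ)²`. -/
theorem wrap_eq_iff (n : ℕ) (c : ℤ × ℤ) (d : box n) :
    wrap n c = d ↔ ∃ i j : ℤ, c = (d.1.1 + i * 2 ^ n, d.1.2 + j * 2 ^ n) := by
  obtain ⟨⟨d1, d2⟩, hd⟩ := d
  simp only [box, Finset.mem_product, Finset.mem_Icc] at hd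
  obtain ⟨⟨ha, hb⟩, hc, he⟩ := hd
  constructor
  · intro h
    have h' := congrArg Subtype.val h
    simp only [wrap, Prod.mk.injEq] at h'
    refine ⟨c.1 / 2 ^ n, c.2 / 2 ^ n, ?_⟩
    ext
    · simp only [← h'.1, Int.emod_add_ediv_mul]
    · simp only [← h'.2, Int.emod_add_ediv_mul]
  · rintro ⟨i, j, rfl⟩
    apply Subtype.ext
    simp only [wrap, Int.add_mul_emod_self_right]
    rw [Int.emod_eq_of_lt ha (by omega), Int.emod_eq_of_lt hc (by omega)]

variable {Ω : Type*} [MeasurableSpace Ω]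

/-- `b k c` is the variable `b_{k,B}` attached to the square `B` of side `2 ^ k` with lower left
corner `c ∈ V_N`, `N = 2 ^ n`. The family is independent and `b_{k,B}` is a centered Gaussian of
variance `2 ^ (-2 k)`. -/
structure IsNoise (n : ℕ) (b : ℕ → box n → Ω → ℝ) (P : Measure Ω) : Prop where
  hasLaw : ∀ k c, HasLaw (b k c) (gaussianReal 0 ((2 : ℝ≥0) ^ (2 * k))⁻¹) P
  indep : iIndepFun (fun i : ℕ × box n => b i.1 i.2) P

/-- The truncated modified branching random walk
`S_z^{N,k₀} = ∑_{k = k₀}^n ∑_{B ∋ z} b^N_{k,B}`, where `N = 2 ^ n`, `B` runs over the squares of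
side `2 ^ k` containing `z`, and `b^N_{k,B} = b_{k,B'}` for the translate `B'` of `B` by an element
of `(N ℤ)²` whose lower left corner is in `V_N`. -/
noncomputable def field (n k₀ : ℕ) (b : ℕ → box n → Ω → ℝ) (z : ℤ × ℤ) (ω : Ω) : ℝ :=
  ∑ k ∈ Finset.Icc k₀ n, ∑ c ∈ cornersAt k z, b k (wrap n c) ω

/-- The maximum `S*_{N,k₀}` of the truncated modified branching random walk over `V_N`. -/
noncomputable def maxField (n k₀ : ℕ) (b : ℕ → box n → Ω → ℝ) (ω : Ω) : ℝ :=
  (box n).sup' (box_nonempty n) (fun z => field n k₀ b z ω)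

end MBRW

/-!
The contributions of the scales to the field at a point `z`, listed from the coarsest to the finest,
are independent standard normal variables: the field at `z` is the endpoint of a Gaussian random
walk indexed by scale. In units of `2 ^ k₀`, the walks at two points at distance about `2 ^ r` use
disjoint squares during their last `r` steps, so that these final stretches are independent. The
proof treats the field with `L` scales as a branching random walk of `L` generations with about
`4 ^ L` leaves.

*High points exist with probability bounded below.* Restrict to a lattice with `4 ^ (L - 1)` points
and call a walk good if its fluctuation around the line of slope `slope L` stays below `1`, ends in
`[0, 1]`, and is below `-4 log d` at each time at distance `d ≥ K` from both ends (`barrier`). The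
slope is chosen so that `L * slope L` is the centring and the Gaussian cost of the slope makes up
for the factor `L ^ (-3 / 2)` of the ballot estimate, so that a walk is good with probability of
order `4 ^ (-L)` (`exists_measureReal_goodSet_ge`). The ballot probabilities are bounded from above
by comparison with the derivative of the heat kernel, a supersolution of the heat equation killed
below a positive level (`setIntegral_dipole_le`, `measureReal_ballot_le`), and from below by the
cycle lemma (`measureReal_ballot_one_ge`); the logarithmic dip costs only a constant factor
(`exists_measureReal_barrier_ge`).

For the second moment, consider a pair of points whose walks have independent final stretches of
length `r`. No information on the correlation of the earlier steps is used: the second walk is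
charged for its last `r` steps only (`measureReal_inter_goodSet_le`). These have to climb out of the
dip, which has probability at most `4 ^ (-r) / min (L - r, r) ^ 2` up to a constant. There are about
`4 ^ r` such points, and the sum over `r` of `1 / min (L - r, r) ^ 2` is bounded uniformly in `L`.
The second moment method then gives a good walk with probability at least some `p > 0` in every
square (`exists_measureReal_square_ge`).

*From probability to expectation.* Let `y` be the expected maximum over a square of side `2 ^ l` of
the field with scales up to `l`, and `M` its centring. A square of side `2 ^ (l + 2)` contains two
such squares at distance `2 ^ l`, on which these fields are independent. The two new scales may be
averaged out, since adding an independent centred field does not decrease the expected maximum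
(`integral_sup'_le_integral_sup'_add`). Using the second square when it contains a point above `M`
and the first otherwise shows that the expected maximum for `l + 2` is at least `y + q (M - y)`,
where `q ≥ p` is the probability of such a point (`IsNoise.integral_subMax_add_two_ge`). Since the
centring grows by at most `4`, a bound `4 / p` for the gap between centring and expected maximum
passes from `l` to `l + 2`.
-/

namespace MBRW
open Set

/-! ### A supersolution of the killed heat equation -/

/-- The function `v ↦ v s^{-3/2} e^{-v²/(2s)}`, a multiple of the space derivative of the heat
kernel at time `s`. It is odd, positive for `v > 0`, and solves the heat equation. -/
noncomputable def dipole (s v : ℝ) : ℝ := v / (s * √s) * Real.exp (-v ^ 2 / (2 * s))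

theorem dipole_nonneg {s v : ℝ} (hs : 0 ≤ s) (hv : 0 ≤ v) : 0 ≤ dipole s v := by
  unfold dipole; positivity

theorem measurable_dipole (s : ℝ) : Measurable (dipole s) := by
  unfold dipole; fun_prop

/-- Completing the square: the product of the two Gaussian factors is a Gaussian density. -/
theorem gaussianPDFReal_mul_dipole {s : ℝ} (hs : 0 < s) (v u : ℝ) :
    gaussianPDFReal v 1 u * dipole s u =
      ((s * √(s + 1))⁻¹ * Real.exp (-v ^ 2 / (2 * (s + 1)))) *
        (gaussianPDFReal (v * s / (s + 1)) (s / (s + 1)).toNNReal u * u) := by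
  have h1 : 0 < s + 1 := by linarith
  have e1 : √(2 * Real.pi * (s / (s + 1))) = √(2 * Real.pi) * (√s / √(s + 1)) := by
    rw [Real.sqrt_mul (by positivity), Real.sqrt_div hs.le]
  have e2 : Real.exp (-(u - v) ^ 2 / 2) * Real.exp (-u ^ 2 / (2 * s)) =
      Real.exp (-v ^ 2 / (2 * (s + 1))) *
        Real.exp (-(u - v * s / (s + 1)) ^ 2 / (2 * (s / (s + 1)))) := by
    rw [← Real.exp_add, ← Real.exp_add]
    congr 1
    field_simp
    ring
  have hw : (0 : ℝ) ≤ s / (s + 1) := by positivity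
  simp only [gaussianPDFReal, dipole, Real.coe_toNNReal _ hw, NNReal.coe_one, mul_one]
  rw [e1]
  have hs1 : 0 < √s := Real.sqrt_pos.2 hs
  have hs2 : 0 < √(s + 1) := Real.sqrt_pos.2 h1
  have hp : 0 < √(2 * Real.pi) := by positivity
  calc _ = (√(2 * Real.pi))⁻¹ * (u / (s * √s)) *
        (Real.exp (-(u - v) ^ 2 / 2) * Real.exp (-u ^ 2 / (2 * s))) := by ring
    _ = _ := by rw [e2]; field_simp

theorem integrable_dipole {s : ℝ} (hs : 0 < s) (v : ℝ) :
    Integrable (dipole s) (gaussianReal v 1) := by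
  have h1 : 0 < s + 1 := by linarith
  rw [gaussianReal_of_var_ne_zero _ one_ne_zero,
    integrable_withDensity_iff_integrable_smul₀' (by fun_prop) (by simp [gaussianPDF])]
  simp only [toReal_gaussianPDF, smul_eq_mul, gaussianPDFReal_mul_dipole hs]
  refine Integrable.const_mul ?_ _
  set w : ℝ≥0 := (s / (s + 1)).toNNReal
  have hw : w ≠ 0 := (Real.toNNReal_pos.2 (by positivity)).ne'
  have := (memLp_id_gaussianReal' (μ := v * s / (s + 1)) (v := w) 1 (by simp)).integrable le_rfl
  rw [gaussianReal_of_var_ne_zero _ hw,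
    integrable_withDensity_iff_integrable_smul₀' (by fun_prop) (by simp [gaussianPDF])] at this
  simpa [toReal_gaussianPDF] using this

/-- `dipole` solves the heat equation: the normal law carries it from time `s` to time `s + 1`. -/
theorem integral_dipole {s : ℝ} (hs : 0 < s) (v : ℝ) :
    ∫ u, dipole s u ∂gaussianReal v 1 = dipole (s + 1) v := by
  have h1 : 0 < s + 1 := by linarith
  rw [integral_gaussianReal_eq_integral_smul one_ne_zero]
  simp only [smul_eq_mul, gaussianPDFReal_mul_dipole hs]
  set w : ℝ≥0 := (s / (s + 1)).toNNReal
  have hw : w ≠ 0 := (Real.toNNReal_pos.2 (by positivity)).ne'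
  have := integral_id_gaussianReal (μ := v * s / (s + 1)) (v := w)
  rw [integral_gaussianReal_eq_integral_smul hw] at this
  simp only [smul_eq_mul] at this
  rw [integral_const_mul, this, dipole]
  have hs2 : 0 < √(s + 1) := Real.sqrt_pos.2 h1
  field_simp

theorem integrableOn_mul_exp_neg_sq :
    IntegrableOn (fun u : ℝ => u * Real.exp (-u ^ 2 / 2)) (Iic 0) := by
  have := (integrable_mul_exp_neg_mul_sq (b := 1 / 2) (by norm_num)).integrableOn (s := Iic 0)
  refine this.congr_fun (fun u _ => ?_) measurableSet_Iic
  simp only; congr 2; ring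

theorem setIntegral_mul_exp_neg_sq :
    ∫ u in Iic (0 : ℝ), u * Real.exp (-u ^ 2 / 2) = -1 := by
  have hd : ∀ u ∈ Iic (0 : ℝ), HasDerivAt (fun u : ℝ => -Real.exp (-u ^ 2 / 2))
      (u * Real.exp (-u ^ 2 / 2)) u := by
    intro u _
    have : HasDerivAt (fun u : ℝ => -u ^ 2 / 2) (-u) u := by
      have := ((hasDerivAt_pow 2 u).neg).div_const 2
      refine this.congr_deriv ?_
      simp
      ring
    refine this.exp.neg.congr_deriv ?_
    ring
  have ht : Filter.Tendsto (fun u : ℝ => -Real.exp (-u ^ 2 / 2)) Filter.atBot (nhds (-0)) := by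
    refine (Real.tendsto_exp_atBot.comp ?_).neg
    have h2 : Filter.Tendsto (fun u : ℝ => u ^ 2) Filter.atBot Filter.atTop := by
      have := Filter.Tendsto.comp (Filter.tendsto_pow_atTop (α := ℝ) (n := 2) two_ne_zero)
        Filter.tendsto_abs_atBot_atTop
      simpa [Function.comp_def] using this
    have h3 := (Filter.tendsto_neg_atTop_atBot.comp h2).atBot_div_const (r := 2) (by norm_num)
    exact h3
  rw [integral_Iic_of_hasDerivAt_of_tendsto' hd integrableOn_mul_exp_neg_sq ht]
  simp

/-- For a starting point `v ≥ 2`, the positive part of `dipole s` on `[1, 2]` outweighs its negative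
part on the negative half-line, under the normal law centred at `v`. -/
theorem setIntegral_dipole_nonneg {s v : ℝ} (hs : 1 ≤ s) (hv : 2 ≤ v) :
    0 ≤ ∫ u in Iio 2, dipole s u ∂gaussianReal v 1 := by
  have hs0 : 0 < s := by linarith
  rw [← integral_indicator measurableSet_Iio, integral_gaussianReal_eq_integral_smul one_ne_zero]
  have hi : Integrable fun u => gaussianPDFReal v 1 u • (Iio 2).indicator (dipole s) u := by
    have := (integrable_dipole hs0 v).indicator (measurableSet_Iio (a := (2 : ℝ)))
    rw [gaussianReal_of_var_ne_zero _ one_ne_zero,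
      integrable_withDensity_iff_integrable_smul₀' (by fun_prop) (by simp [gaussianPDF])] at this
    simpa [toReal_gaussianPDF] using this
  -- `G` is a lower bound of the integrand with integral `c * (1 - 1) = 0`.
  set c : ℝ := (√(2 * Real.pi))⁻¹ * (s * √s)⁻¹ * Real.exp (-v ^ 2 / 2) with hc
  have hc0 : 0 ≤ c := by positivity
  let G : ℝ → ℝ := fun u => c * ((Ico 1 2).indicator 1 u +
    (Iic 0).indicator (fun u => u * Real.exp (-u ^ 2 / 2)) u)
  have hGi1 : Integrable ((Ico (1 : ℝ) 2).indicator (1 : ℝ → ℝ)) :=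
    IntegrableOn.integrable_indicator (by
      rw [show (1 : ℝ → ℝ) = fun _ => (1 : ℝ) from rfl]
      exact integrableOn_const (by simp)) measurableSet_Ico
  have hGi2 := integrableOn_mul_exp_neg_sq.integrable_indicator measurableSet_Iic
  have hG : ∫ u, G u = 0 := by
    simp only [G]
    rw [integral_const_mul, integral_add hGi1 hGi2, integral_indicator measurableSet_Iic,
      setIntegral_mul_exp_neg_sq, integral_indicator measurableSet_Ico]
    simp
    right; norm_num
  rw [← hG]
  refine integral_mono ((hGi1.add hGi2).const_mul c) hi fun u => ?_
  have key : gaussianPDFReal v 1 u * dipole s u =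
      c * (u * Real.exp (u * v - u ^ 2 / 2 - u ^ 2 / (2 * s))) := by
    have : Real.exp (u * v - u ^ 2 / 2 - u ^ 2 / (2 * s)) * Real.exp (-v ^ 2 / 2) =
        Real.exp (-(u - v) ^ 2 / 2) * Real.exp (-u ^ 2 / (2 * s)) := by
      rw [← Real.exp_add, ← Real.exp_add]; congr 1; ring
    simp only [gaussianPDFReal, dipole, NNReal.coe_one, mul_one, hc]
    linear_combination (-(√(2 * Real.pi))⁻¹ * (s * √s)⁻¹ * u) * this
  have hus : u ^ 2 / (2 * s) ≤ u ^ 2 / 2 := by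
    apply div_le_div_of_nonneg_left (sq_nonneg u) (by norm_num); linarith
  have hus0 : 0 ≤ u ^ 2 / (2 * s) := by positivity
  simp only [G, smul_eq_mul]
  rcases lt_or_ge u 2 with h2 | h2
  · rw [indicator_of_mem (show u ∈ Iio 2 from h2), key]
    refine mul_le_mul_of_nonneg_left ?_ hc0
    rcases le_or_gt u 0 with h0 | h0
    · rw [indicator_of_notMem (by simp; intro; linarith), indicator_of_mem (show u ∈ Iic 0 from h0),
        zero_add]
      refine mul_le_mul_of_nonpos_left (Real.exp_le_exp.2 ?_) h0
      have : u * v ≤ 0 := mul_nonpos_of_nonpos_of_nonneg h0 (by linarith)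
      linarith
    · rw [indicator_of_notMem (s := Iic 0) (by simpa using h0), add_zero]
      by_cases h1 : 1 ≤ u
      · rw [indicator_of_mem (show u ∈ Ico 1 2 from ⟨h1, h2⟩), Pi.one_apply]
        refine one_le_mul_of_one_le_of_one_le h1 (Real.one_le_exp ?_)
        nlinarith
      · rw [indicator_of_notMem (by simp; intro; linarith)]
        positivity
  · rw [indicator_of_notMem (show u ∉ Iio 2 by simpa using h2),
      indicator_of_notMem (by simp; intro; linarith),
      indicator_of_notMem (s := Iic 0) (by simp; linarith)]
    simp

/-- `dipole` is a supersolution of the heat equation killed below `2`. -/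
theorem setIntegral_dipole_le {s v : ℝ} (hs : 1 ≤ s) (hv : 2 ≤ v) :
    ∫ u in Ici 2, dipole s u ∂gaussianReal v 1 ≤ dipole (s + 1) v := by
  have hs0 : 0 < s := by linarith
  have h := integral_add_compl (measurableSet_Iio (a := (2 : ℝ))) (integrable_dipole hs0 v)
  rw [integral_dipole hs0, compl_Iio] at h
  linarith [setIntegral_dipole_nonneg hs hv]

/-! ### Gaussian walks and the upper ballot estimate -/

/-- The standard normal law on `ℝ^r`: the law of the increments of a Gaussian random walk. -/
noncomputable def stdNormal (r : ℕ) : Measure (Fin r → ℝ) :=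
  Measure.pi fun _ => gaussianReal 0 1

instance (r : ℕ) : IsProbabilityMeasure (stdNormal r) := by
  unfold stdNormal; infer_instance

/-- The position after `m` steps of the walk with increments `x`. -/
noncomputable def psum {r : ℕ} (x : Fin r → ℝ) (m : ℕ) : ℝ := ∑ i : Fin r with i.val < m, x i

@[fun_prop]
theorem measurable_psum {r : ℕ} (m : ℕ) : Measurable fun x : Fin r → ℝ => psum x m := by
  unfold psum; fun_prop

@[simp] theorem psum_zero {r : ℕ} (x : Fin r → ℝ) : psum x 0 = 0 := by simp [psum]

theorem psum_cons_succ {r : ℕ} (y : ℝ) (x : Fin r → ℝ) (m : ℕ) :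
    psum (Fin.cons y x : Fin (r + 1) → ℝ) (m + 1) = y + psum x m := by
  simp [psum, Finset.sum_filter, Fin.sum_univ_succ]

theorem psum_self {r : ℕ} (x : Fin r → ℝ) : psum x r = ∑ i, x i := by simp [psum]

/-- The walks of length `r` that never exceed `a` and end in `[a - h, a]`. -/
def ballot (r : ℕ) (a h : ℝ) : Set (Fin r → ℝ) :=
  {x | (∀ m ≤ r, psum x m ≤ a) ∧ a - h ≤ psum x r}

theorem measurableSet_ballot (r : ℕ) (a h : ℝ) : MeasurableSet (ballot r a h) := by
  have : ballot r a h = (⋂ m ∈ Finset.range (r + 1), {x | psum x m ≤ a}) ∩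
      {x | a - h ≤ psum x r} := by
    ext x; simp [ballot]
  rw [this]
  exact (Finset.measurableSet_biInter _ fun m _ =>
    measurableSet_le (measurable_psum m) measurable_const).inter
    (measurableSet_le measurable_const (measurable_psum r))

theorem stdNormal_succ_apply (r : ℕ) {B : Set (Fin (r + 1) → ℝ)} (hB : MeasurableSet B) :
    stdNormal (r + 1) B = ∫⁻ y, stdNormal r {x | (Fin.cons y x : Fin (r + 1) → ℝ) ∈ B}
      ∂gaussianReal 0 1 := by
  have hp := measurePreserving_piFinSuccAbove (fun _ : Fin (r + 1) => gaussianReal 0 1) 0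
  have hs := hp.symm
  unfold stdNormal
  rw [← hs.measure_preimage hB.nullMeasurableSet, Measure.prod_apply (hs.measurable hB)]
  refine lintegral_congr fun y => congrArg _ ?_
  ext x
  simp [MeasurableEquiv.piFinSuccAbove, Fin.insertNthEquiv]

/-- Induction on the number of steps, comparing the probability with `dipole`: conditioning on the
first step turns the bound for `r` steps into an integral over the half-line `[2, ∞)`. The time is
shifted by `(h + 2) ^ 2` and the space by `2`, so that the bound holds for `r = 0`. -/
theorem ballot_le_dipole (r : ℕ) {h : ℝ} (hh : 0 ≤ h) {a : ℝ} (ha : 0 ≤ a) :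
    stdNormal r (ballot r a h) ≤
      ENNReal.ofReal ((h + 2) ^ 3 * dipole ((h + 2) ^ 2 + r) (a + 2)) := by
  induction r generalizing a with
  | zero =>
    by_cases hah : a ≤ h
    · refine prob_le_one.trans ?_
      rw [ENNReal.one_le_ofReal]
      have h2 : 0 < h + 2 := by linarith
      have he : (1 : ℝ) / 2 ≤ Real.exp (-(a + 2) ^ 2 / (2 * (h + 2) ^ 2)) := by
        have h3 : -(1 / 2 : ℝ) ≤ -(a + 2) ^ 2 / (2 * (h + 2) ^ 2) := by
          rw [le_div_iff₀ (by positivity)]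
          nlinarith
        have := Real.add_one_le_exp (-(1 / 2 : ℝ))
        have := Real.exp_le_exp.2 h3
        linarith
      unfold dipole
      rw [Nat.cast_zero, add_zero, Real.sqrt_sq h2.le]
      have : (h + 2) ^ 3 * ((a + 2) / ((h + 2) ^ 2 * (h + 2)) *
          Real.exp (-(a + 2) ^ 2 / (2 * (h + 2) ^ 2))) =
          (a + 2) * Real.exp (-(a + 2) ^ 2 / (2 * (h + 2) ^ 2)) := by
        field_simp
      rw [this]
      nlinarith
    · have : ballot 0 a h = ∅ := by
        ext x
        simp only [ballot, psum_zero, mem_ofPred_eq, mem_empty_iff_false, iff_false]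
        rintro ⟨_, h1⟩
        apply hah; linarith
      simp [this]
  | succ r ih =>
    rw [stdNormal_succ_apply r (measurableSet_ballot _ _ _)]
    set K := (h + 2) ^ 3
    set s : ℝ := (h + 2) ^ 2 + r
    have hK : 0 ≤ K := by positivity
    have hs : 1 ≤ s := by
      have : (0 : ℝ) ≤ r := Nat.cast_nonneg r
      simp only [s]; nlinarith
    calc _ ≤ ∫⁻ y, (Ici 2).indicator (fun u => ENNReal.ofReal (K * dipole s u)) (a + 2 - y)
          ∂gaussianReal 0 1 := by
          refine lintegral_mono fun y => ?_
          by_cases hy : y ≤ a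
          · rw [indicator_of_mem (by simp; linarith)]
            refine (measure_mono ?_).trans ((ih (a := a - y) (by linarith)).trans_eq ?_)
            · rintro x ⟨h1, h2⟩
              refine ⟨fun m hm => ?_, ?_⟩
              · have := h1 (m + 1) (by omega)
                rw [psum_cons_succ] at this
                linarith
              · rw [psum_cons_succ] at h2
                linarith
            · congr 3; ring
          · have : {x | (Fin.cons y x : Fin (r + 1) → ℝ) ∈ ballot (r + 1) a h} = ∅ := by
              ext x
              simp only [mem_ofPred_eq, mem_empty_iff_false, iff_false]
              rintro ⟨h1, _⟩
              have := h1 1 (by omega)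
              rw [psum_cons_succ, psum_zero, add_zero] at this
              exact hy this
            rw [this]; simp
      _ = ∫⁻ u, (Ici 2).indicator (fun u => ENNReal.ofReal (K * dipole s u)) u
          ∂gaussianReal (a + 2) 1 := by
          have := gaussianReal_map_const_sub (μ := 0) (v := 1) (a + 2)
          rw [sub_zero] at this
          rw [← this, lintegral_map _ (by fun_prop)]
          exact (((measurable_dipole s).const_mul K).ennreal_ofReal).indicator measurableSet_Ici
      _ = ENNReal.ofReal (∫ u in Ici 2, K * dipole s u ∂gaussianReal (a + 2) 1) := by
          rw [lintegral_indicator measurableSet_Ici, ofReal_integral_eq_lintegral_ofReal]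
          · exact ((integrable_dipole (by linarith) _).const_mul K).integrableOn
          · refine (ae_restrict_iff' measurableSet_Ici).2
              (Filter.Eventually.of_forall fun u hu => ?_)
            exact mul_nonneg hK (dipole_nonneg (by linarith) (by have := mem_Ici.1 hu; linarith))
      _ ≤ _ := by
          apply ENNReal.ofReal_le_ofReal
          rw [integral_const_mul]
          refine mul_le_mul_of_nonneg_left ?_ hK
          have := setIntegral_dipole_le hs (show 2 ≤ a + 2 by linarith)
          rwa [show s + 1 = (h + 2) ^ 2 + ((r + 1 : ℕ) : ℝ) by simp only [s]; push_cast; ring]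
            at this

/-- Ballot estimate. The power `(h + 2) ^ 3` is not optimal but suffices. -/
theorem measureReal_ballot_le {r : ℕ} (hr : 1 ≤ r) {a h : ℝ} (ha : 0 ≤ a) (hh : 0 ≤ h) :
    (stdNormal r).real (ballot r a h) ≤ (h + 2) ^ 3 * (a + 2) / (r * √r) := by
  have h0 : 0 ≤ (h + 2) ^ 3 * dipole ((h + 2) ^ 2 + r) (a + 2) :=
    mul_nonneg (by positivity) (dipole_nonneg (by positivity) (by linarith))
  refine (ENNReal.toReal_le_of_le_ofReal h0 (ballot_le_dipole r hh ha)).trans ?_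
  rw [mul_div_assoc]
  refine mul_le_mul_of_nonneg_left ?_ (by positivity)
  have hr' : (1 : ℝ) ≤ r := by exact_mod_cast hr
  unfold dipole
  calc _ ≤ (a + 2) / (((h + 2) ^ 2 + r) * √((h + 2) ^ 2 + r)) * 1 := by
        refine mul_le_mul_of_nonneg_left ?_ (by positivity)
        rw [Real.exp_le_one_iff]
        apply div_nonpos_of_nonpos_of_nonneg
        · nlinarith
        · positivity
    _ ≤ _ := by
        rw [mul_one]
        have : (r : ℝ) ≤ (h + 2) ^ 2 + r := by nlinarith
        gcongr

/-! ### Gaussian laws: sums, sections, constant drift -/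

/-- The sum of independent centred Gaussian variables is Gaussian. -/
theorem hasLaw_sum_gaussianReal {Ω ι : Type*} [MeasurableSpace Ω] {P : Measure Ω}
    [IsProbabilityMeasure P] {X : ι → Ω → ℝ} {v : ι → ℝ≥0}
    (hX : ∀ i, HasLaw (X i) (gaussianReal 0 (v i)) P) (hi : iIndepFun X P) (s : Finset ι) :
    HasLaw (fun ω => ∑ i ∈ s, X i ω) (gaussianReal 0 (∑ i ∈ s, v i)) P := by
  classical
  induction s using Finset.induction_on with
  | empty => simpa using hasLaw_dirac_iff.2 (Filter.Eventually.of_forall fun _ => rfl)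
  | insert i s his ih =>
    have hind := (hi.indepFun_finsetSum_of_notMem₀ (fun i => (hX i).aemeasurable) his).symm
    have he : (∑ j ∈ s, X j) = fun ω => ∑ j ∈ s, X j ω := by ext ω; simp
    rw [he] at hind
    refine ⟨?_, ?_⟩
    · exact Finset.aemeasurable_fun_sum _ fun i _ => (hX i).aemeasurable
    · have := gaussianReal_add_gaussianReal_of_indepFun hind (hX i).map_eq ih.map_eq
      simp only [Finset.sum_insert his]
      simpa [Pi.add_def] using this

theorem hasLaw_stdNormal_eval (r : ℕ) (i : Fin r) :
    HasLaw (fun x : Fin r → ℝ => x i) (gaussianReal 0 1) (stdNormal r) :=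
  (measurePreserving_eval (fun _ : Fin r => gaussianReal 0 1) i).hasLaw

theorem iIndepFun_stdNormal (r : ℕ) :
    iIndepFun (fun (i : Fin r) (x : Fin r → ℝ) => x i) (stdNormal r) :=
  iIndepFun_pi (X := fun (_ : Fin r) (y : ℝ) => y) fun _ => aemeasurable_id

theorem hasLaw_stdNormal_comp {r L : ℕ} {σ : Fin r → Fin L} (hσ : σ.Injective) :
    HasLaw (fun (x : Fin L → ℝ) i => x (σ i)) (stdNormal r) (stdNormal L) :=
  ((iIndepFun_stdNormal L).precomp hσ).hasLaw_pi fun i => hasLaw_stdNormal_eval L (σ i)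

theorem hasLaw_psum_self (r : ℕ) :
    HasLaw (fun x : Fin r → ℝ => psum x r) (gaussianReal 0 r) (stdNormal r) := by
  have := hasLaw_sum_gaussianReal (hasLaw_stdNormal_eval r) (iIndepFun_stdNormal r) Finset.univ
  simpa [psum_self] using this

/-- The density of `N(0, L)` on `[0, 1]` is at least `e^{-1/2} / √(2 π L)`, which exceeds
`1 / (5 √L)`. -/
theorem measureReal_gaussianReal_Icc_ge {L : ℕ} (hL : 1 ≤ L) :
    1 / (5 * √L) ≤ (gaussianReal 0 L).real (Icc 0 1) := by
  have hL' : (1 : ℝ) ≤ L := by exact_mod_cast hL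
  have hL0 : (L : ℝ≥0) ≠ 0 := by exact_mod_cast (by omega : L ≠ 0)
  rw [measureReal_def, gaussianReal_apply_eq_integral _ hL0, ENNReal.toReal_ofReal
    (setIntegral_nonneg measurableSet_Icc fun x _ => gaussianPDFReal_nonneg _ _ _)]
  have hs : 0 < √(L : ℝ) := Real.sqrt_pos.2 (by linarith)
  have : ∫ x in Icc (0 : ℝ) 1, 1 / (5 * √(L : ℝ)) = 1 / (5 * √L) := by simp
  rw [← this]
  refine setIntegral_mono_on (integrableOn_const (by simp))
    (integrable_gaussianPDFReal _ _).integrableOn measurableSet_Icc fun x hx => ?_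
  simp only [gaussianPDFReal, NNReal.coe_natCast, sub_zero]
  have h1 : √(2 * Real.pi * L) ≤ 5 / 2 * (51 / 50) * √L := by
    rw [Real.sqrt_mul (by positivity)]
    refine mul_le_mul_of_nonneg_right ?_ hs.le
    rw [Real.sqrt_le_left (by norm_num)]
    have := Real.pi_lt_d2
    linarith
  have h2 : (1 : ℝ) / 1.65 ≤ Real.exp (-x ^ 2 / (2 * L)) := by
    have h3 : -(1 / 2 : ℝ) ≤ -x ^ 2 / (2 * L) := by
      rw [le_div_iff₀ (by positivity)]
      have : x ^ 2 ≤ 1 := by nlinarith [hx.1, hx.2]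
      nlinarith
    refine le_trans ?_ (Real.exp_le_exp.2 h3)
    have h4 : Real.exp (1 / 2) ≤ 1.65 := by
      have h5 : Real.exp (1 / 2) ^ 2 ≤ 1.65 ^ 2 := by
        rw [← Real.exp_nat_mul]
        have := Real.exp_one_lt_d9
        norm_num at this ⊢
        linarith
      exact le_of_sq_le_sq h5 (by norm_num)
    rw [Real.exp_neg, ← one_div]
    exact one_div_le_one_div_of_le (Real.exp_pos _) h4
  have hq : 0 < √(2 * Real.pi * L) := by positivity
  calc 1 / (5 * √(L : ℝ)) ≤ (5 / 2 * (51 / 50) * √(L : ℝ))⁻¹ * (1 / 1.65) := by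
        rw [← one_div, one_div_mul_one_div]
        apply one_div_le_one_div_of_le (by positivity)
        nlinarith
    _ ≤ _ := by
        refine mul_le_mul ((inv_le_inv₀ (by positivity) hq).2 h1) h2 (by norm_num) (by positivity)

/-- If `V` is a standard normal vector independent of `Z` then, conditionally on `Z ∈ A`, the
probability of `(Z, V) ∈ B` is at most the largest probability of a section of `B` over `A`. -/
theorem measure_inter_le_of_indepFun {Ω α : Type*} [MeasurableSpace Ω] [MeasurableSpace α]
    {P : Measure Ω} [IsProbabilityMeasure P] {r : ℕ} {Z : Ω → α} {V : Ω → Fin r → ℝ}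
    (hZ : AEMeasurable Z P) (hV : HasLaw V (stdNormal r) P) (hind : IndepFun Z V P)
    {A : Set α} (hA : MeasurableSet A) {B : Set (α × (Fin r → ℝ))} (hB : MeasurableSet B)
    {κ : ℝ} (hκ : 0 ≤ κ) (h : ∀ z ∈ A, (stdNormal r).real (Prod.mk z ⁻¹' B) ≤ κ) :
    P.real {ω | Z ω ∈ A ∧ (Z ω, V ω) ∈ B} ≤ P.real {ω | Z ω ∈ A} * κ := by
  have hmap := (indepFun_iff_map_prod_eq_prod_map_map hZ hV.aemeasurable).1 hind
  have : IsProbabilityMeasure (P.map Z) := Measure.isProbabilityMeasure_map hZ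
  have hS : MeasurableSet ((A ×ˢ univ) ∩ B) := (hA.prod MeasurableSet.univ).inter hB
  have e1 : P {ω | Z ω ∈ A ∧ (Z ω, V ω) ∈ B} = (P.map Z).prod (stdNormal r) ((A ×ˢ univ) ∩ B) := by
    rw [← hV.map_eq, ← hmap, Measure.map_apply_of_aemeasurable (hZ.prodMk hV.aemeasurable) hS]
    congr 1; ext ω; simp
  have e2 : P {ω | Z ω ∈ A} = P.map Z A := (Measure.map_apply_of_aemeasurable hZ hA).symm
  rw [measureReal_def, measureReal_def, e1, e2, ← ENNReal.toReal_ofReal hκ, ← ENNReal.toReal_mul]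
  refine ENNReal.toReal_mono (by finiteness) ?_
  rw [Measure.prod_apply hS, mul_comm, ← setLIntegral_const, ← lintegral_indicator hA]
  refine lintegral_mono fun z => ?_
  by_cases hz : z ∈ A
  · rw [indicator_of_mem hz]
    refine ENNReal.le_ofReal_iff_toReal_le (by finiteness) hκ |>.2 (le_trans ?_ (h z hz))
    refine measureReal_mono ?_
    intro v hv; exact hv.2
  · have : Prod.mk z ⁻¹' (A ×ˢ univ ∩ B) = ∅ := by ext v; simp [hz]
    rw [this]; simp

theorem gaussianReal_neg_eq_withDensity (β : ℝ) :
    gaussianReal (-β) 1 = (gaussianReal 0 1).withDensity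
      fun y => ENNReal.ofReal (Real.exp (-β * y - β ^ 2 / 2)) := by
  rw [gaussianReal_of_var_ne_zero _ one_ne_zero, gaussianReal_of_var_ne_zero _ one_ne_zero,
    ← withDensity_mul _ (by fun_prop) (by fun_prop)]
  congr 1
  ext y
  simp only [gaussianPDF, Pi.mul_apply]
  rw [← ENNReal.ofReal_mul (gaussianPDFReal_nonneg _ _ _)]
  congr 1
  simp only [gaussianPDFReal, mul_assoc, ← Real.exp_add]
  congr 2
  simp; ring

/-- The Cameron–Martin formula for a constant drift. -/
theorem stdNormal_map_sub (r : ℕ) (β : ℝ) :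
    (stdNormal r).map (fun x i => x i - β) = (stdNormal r).withDensity
      fun y => ENNReal.ofReal (Real.exp (-β * psum y r - r * β ^ 2 / 2)) := by
  have e1 : (stdNormal r).map (fun x i => x i - β) =
      Measure.pi fun _ : Fin r => gaussianReal (-β) 1 := by
    unfold stdNormal
    rw [Measure.pi_map_pi (f := fun _ y => y - β) fun _ => by fun_prop]
    simp [gaussianReal_map_sub_const]
  rw [e1]
  refine Measure.pi_eq fun s hs => ?_
  have hf : Measurable fun y : ℝ => ENNReal.ofReal (Real.exp (-β * y - β ^ 2 / 2)) := by fun_prop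
  rw [withDensity_apply _ (MeasurableSet.univ_pi hs),
    ← lintegral_indicator (MeasurableSet.univ_pi hs)]
  have e2 : (fun y : Fin r → ℝ => (univ.pi s).indicator
      (fun y => ENNReal.ofReal (Real.exp (-β * psum y r - r * β ^ 2 / 2))) y) = fun y =>
      ∏ i, (s i).indicator (fun y : ℝ => ENNReal.ofReal (Real.exp (-β * y - β ^ 2 / 2))) (y i) := by
    ext y
    by_cases hy : y ∈ univ.pi s
    · rw [indicator_of_mem hy,
        Finset.prod_congr rfl fun i _ => indicator_of_mem (hy i (mem_univ i)) _,
        ← ENNReal.ofReal_prod_of_nonneg (fun i _ => (Real.exp_pos _).le), ← Real.exp_sum, psum_self]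
      congr 2
      rw [Finset.sum_sub_distrib, ← Finset.mul_sum]
      simp; ring
    · rw [indicator_of_notMem hy]
      simp only [mem_pi, mem_univ, forall_const, not_forall] at hy
      obtain ⟨i, hi⟩ := hy
      exact (Finset.prod_eq_zero (Finset.mem_univ i) (indicator_of_notMem hi _)).symm
  rw [e2, lintegral_prod_eq_prod_lintegral_of_indepFun Finset.univ
    (fun (i : Fin r) (y : Fin r → ℝ) => (s i).indicator
      (fun y : ℝ => ENNReal.ofReal (Real.exp (-β * y - β ^ 2 / 2))) (y i))
    ((iIndepFun_stdNormal r).comp (fun i => (s i).indicator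
      (fun y : ℝ => ENNReal.ofReal (Real.exp (-β * y - β ^ 2 / 2)))) fun i => hf.indicator (hs i))
    fun i => (hf.indicator (hs i)).comp (measurable_pi_apply i)]
  refine Finset.prod_congr rfl fun i _ => ?_
  rw [gaussianReal_neg_eq_withDensity, withDensity_apply _ (hs i), ← lintegral_indicator (hs i)]
  exact (hasLaw_stdNormal_eval r i).lintegral_comp (hf.indicator (hs i)).aemeasurable

/-- Removing a drift `β` from a walk that must end above `c`. -/
theorem stdNormal_real_shift_le {r : ℕ} {β c : ℝ} (hβ : 0 ≤ β) {A : Set (Fin r → ℝ)}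
    (hA : MeasurableSet A) (hc : ∀ y ∈ A, c ≤ psum y r) :
    (stdNormal r).real {x | (fun i => x i - β) ∈ A} ≤
      Real.exp (-β * c - r * β ^ 2 / 2) * (stdNormal r).real A := by
  have hm : Measurable fun (x : Fin r → ℝ) i => x i - β := by fun_prop
  have e : stdNormal r {x | (fun i => x i - β) ∈ A} = (stdNormal r).map (fun x i => x i - β) A :=
    (Measure.map_apply hm hA).symm
  rw [measureReal_def, measureReal_def, e, stdNormal_map_sub, withDensity_apply _ hA,
    ← ENNReal.toReal_ofReal (Real.exp_pos (-β * c - r * β ^ 2 / 2)).le, ← ENNReal.toReal_mul]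
  refine ENNReal.toReal_mono (by finiteness) ?_
  rw [← setLIntegral_const]
  refine setLIntegral_mono' hA fun y hy => ENNReal.ofReal_le_ofReal (Real.exp_le_exp.2 ?_)
  nlinarith [hc y hy]

/-- Removing a drift `β` from a walk that must end below `c`. -/
theorem stdNormal_real_shift_ge {r : ℕ} {β c : ℝ} (hβ : 0 ≤ β) {A : Set (Fin r → ℝ)}
    (hA : MeasurableSet A) (hc : ∀ y ∈ A, psum y r ≤ c) :
    Real.exp (-β * c - r * β ^ 2 / 2) * (stdNormal r).real A ≤
      (stdNormal r).real {x | (fun i => x i - β) ∈ A} := by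
  have hm : Measurable fun (x : Fin r → ℝ) i => x i - β := by fun_prop
  have e : stdNormal r {x | (fun i => x i - β) ∈ A} = (stdNormal r).map (fun x i => x i - β) A :=
    (Measure.map_apply hm hA).symm
  have hfin : stdNormal r {x | (fun i => x i - β) ∈ A} ≠ ⊤ := by finiteness
  rw [measureReal_def, measureReal_def,
    ← ENNReal.toReal_ofReal (Real.exp_pos (-β * c - r * β ^ 2 / 2)).le, ← ENNReal.toReal_mul]
  refine ENNReal.toReal_mono hfin ?_
  rw [e, stdNormal_map_sub, withDensity_apply _ hA, ← setLIntegral_const]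
  refine setLIntegral_mono' hA fun y hy => ENNReal.ofReal_le_ofReal (Real.exp_le_exp.2 ?_)
  nlinarith [hc y hy]

/-! ### The cycle lemma and the position at an intermediate time -/

/-- Rotating the increments of a walk so that they start where the walk, minus the linear
interpolation of its endpoints, is maximal, makes the walk stay below this interpolation. -/
theorem exists_rotation_mem_ballot {L : ℕ} [NeZero L] (x : Fin L → ℝ) (hx : psum x L ∈ Icc 0 1) :
    ∃ j : Fin L, (fun i => x (i + j)) ∈ ballot L 1 1 := by
  have hL : 0 < L := Nat.pos_of_ne_zero (NeZero.ne L)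
  have hL' : (0 : ℝ) < L := by exact_mod_cast hL
  -- `e` is the periodic extension of the increments and `T` the walk with these increments.
  let e : ℕ → ℝ := fun i => x ⟨i % L, Nat.mod_lt _ hL⟩
  let T : ℕ → ℝ := fun m => ∑ i ∈ Finset.range m, e i
  have hp : ∀ (y : Fin L → ℝ) (f : ℕ → ℝ), (∀ i : Fin L, y i = f i.val) → ∀ m ≤ L,
      psum y m = ∑ i ∈ Finset.range m, f i := by
    intro y f hyf m hm
    unfold psum
    simp only [hyf]
    rw [Finset.sum_filter, Fin.sum_univ_eq_sum_range (fun i => if i < m then f i else 0) L,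
      ← Finset.sum_filter]
    congr 1
    ext i; simp; omega
  have hT : ∀ m ≤ L, psum x m = T m :=
    hp x e fun i => by simp only [e, Nat.mod_eq_of_lt i.2]
  have hTL : ∀ m, T (m + L) = T m + T L := by
    intro m
    simp only [T]
    rw [add_comm m L, Finset.sum_range_add, add_comm]
    congr 1
    exact Finset.sum_congr rfl fun i _ => by simp only [e, Nat.add_mod_left]
  obtain ⟨j, -, hj⟩ := Finset.exists_max_image Finset.univ
    (fun j : Fin L => T j.val - j.val / L * T L) Finset.univ_nonempty
  have hmax : ∀ m ≤ L, T (j.val + m) - (j.val + m) / L * T L ≤ T j.val - j.val / L * T L := by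
    intro m hm
    rcases lt_or_ge (j.val + m) L with h | h
    · simpa using hj ⟨j.val + m, h⟩ (Finset.mem_univ _)
    · have hlt : j.val + m - L < L := by have := j.2; omega
      have h1 := hj ⟨j.val + m - L, hlt⟩ (Finset.mem_univ _)
      have h2 := hTL (j.val + m - L)
      rw [Nat.sub_add_cancel h] at h2
      rw [h2]
      refine le_trans (le_of_eq ?_) h1
      simp only
      rw [Nat.cast_sub h]
      push_cast
      field_simp
      ring
  have hrot : ∀ m ≤ L, psum (fun i => x (i + j)) m = T (j.val + m) - T j.val := by
    intro m hm
    rw [hp (fun i => x (i + j)) (fun i => e (j.val + i)) (fun i => ?_) m hm]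
    · simp only [T]
      rw [Finset.sum_range_add]; ring
    · simp only [e]
      congr 1
      ext
      simp [Fin.val_add, add_comm]
  rw [hT L le_rfl] at hx
  refine ⟨j, fun m hm => ?_, ?_⟩
  · rw [hrot m hm]
    have h1 := hmax m hm
    have h2 : ((j.val : ℝ) + m) / L * T L = j.val / L * T L + m / L * T L := by ring
    have h3 : (m : ℝ) / L ≤ 1 := by
      rw [div_le_one hL']; exact_mod_cast hm
    have h4 : (m : ℝ) / L * T L ≤ 1 := mul_le_one₀ h3 hx.1 hx.2
    linarith
  · rw [hrot L le_rfl, hTL]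
    linarith [hx.1]

/-- Lower ballot estimate: the endpoint lies in `[0, 1]` with probability of order `1 / √L` and, by
exchangeability of the increments, at least one in `L` of the rotations of such a walk is good. -/
theorem measureReal_ballot_one_ge {L : ℕ} (hL : 1 ≤ L) :
    1 / (5 * (L * √L)) ≤ (stdNormal L).real (ballot L 1 1) := by
  have : NeZero L := ⟨by omega⟩
  have hL' : (1 : ℝ) ≤ L := by exact_mod_cast hL
  have h1 : (stdNormal L).real {x | psum x L ∈ Icc 0 1} = (gaussianReal 0 L).real (Icc 0 1) :=
    (hasLaw_psum_self L).measureReal_eq (p := fun y => y ∈ Icc 0 1) measurableSet_Icc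
  have h2 : {x : Fin L → ℝ | psum x L ∈ Icc 0 1} ⊆
      ⋃ j ∈ (Finset.univ : Finset (Fin L)), {x | (fun i => x (i + j)) ∈ ballot L 1 1} := by
    intro x hx
    simpa using exists_rotation_mem_ballot x hx
  have h3 : ∀ j : Fin L, (stdNormal L).real {x | (fun i => x (i + j)) ∈ ballot L 1 1} =
      (stdNormal L).real (ballot L 1 1) := fun j =>
    (hasLaw_stdNormal_comp (σ := fun i => i + j) (add_left_injective j)).measureReal_eq
      (p := fun y => y ∈ ballot L 1 1) (measurableSet_ballot L 1 1)
  have h4 := (measureReal_mono h2 (measure_ne_top _ _)).trans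
    (measureReal_biUnion_finset_le (μ := stdNormal L) Finset.univ _)
  simp only [h3, h1, Finset.sum_const, Finset.card_univ, Fintype.card_fin, nsmul_eq_mul] at h4
  have h5 := (measureReal_gaussianReal_Icc_ge hL).trans h4
  have hs : 0 < √(L : ℝ) := Real.sqrt_pos.2 (by linarith)
  rw [div_le_iff₀ (by positivity)] at h5 ⊢
  linarith

theorem psum_add {t r : ℕ} (x : Fin (t + r) → ℝ) (m : ℕ) :
    psum x (t + m) = psum x t + psum (fun i => x (Fin.natAdd t i)) m := by
  simp [psum, Finset.sum_filter, Fin.sum_univ_add, Nat.lt_add_right]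

theorem psum_castAdd {t r : ℕ} (x : Fin (t + r) → ℝ) {m : ℕ} (hm : m ≤ t) :
    psum (fun i => x (Fin.castAdd r i)) m = psum x m := by
  simp only [psum, Finset.sum_filter, Fin.sum_univ_add, Fin.val_castAdd, Fin.val_natAdd,
    left_eq_add]
  exact Finset.sum_eq_zero fun i _ => if_neg (by omega)

/-- A walk in the ballot event is within `h` of the barrier at time `t` with probability at most the
product of two ballot probabilities, one for the first `t` steps and one for the last `r`. -/
theorem measureReal_ballot_inter_le {t r : ℕ} (ht : 1 ≤ t) (hr : 1 ≤ r) {h : ℝ} (hh : 0 ≤ h) :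
    (stdNormal (t + r)).real {x | x ∈ ballot (t + r) 1 1 ∧ -h ≤ psum x t} ≤
      81 * (h + 3) ^ 4 / ((t * √t) * (r * √r)) := by
  let Z : (Fin (t + r) → ℝ) → Fin t → ℝ := fun x i => x (Fin.castAdd r i)
  let V : (Fin (t + r) → ℝ) → Fin r → ℝ := fun x i => x (Fin.natAdd t i)
  have hZ : HasLaw Z (stdNormal t) (stdNormal (t + r)) :=
    hasLaw_stdNormal_comp (Fin.castAdd_injective t r)
  have hV : HasLaw V (stdNormal r) (stdNormal (t + r)) :=
    hasLaw_stdNormal_comp (Fin.natAdd_injective r t)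
  have hind : IndepFun Z V (stdNormal (t + r)) := by
    set S := Finset.univ.map (Fin.castAddEmb r : Fin t ↪ Fin (t + r)) with hS
    set T := Finset.univ.map (Fin.natAddEmb t : Fin r ↪ Fin (t + r)) with hT
    have hd : Disjoint S T := by
      rw [Finset.disjoint_left]
      intro i hi hi'
      simp only [hS, hT, Finset.mem_map, Finset.mem_univ, true_and] at hi hi'
      obtain ⟨a, rfl⟩ := hi
      obtain ⟨b, hb⟩ := hi'
      have := congrArg Fin.val hb
      simp at this; omega
    have h0 := (iIndepFun_stdNormal (t + r)).indepFun_finset _ _ hd (fun i => by fun_prop)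
    exact h0.comp (φ := fun (y : S → ℝ) (i : Fin t) => y ⟨Fin.castAdd r i, by simp [hS]⟩)
      (ψ := fun (y : T → ℝ) (i : Fin r) => y ⟨Fin.natAdd t i, by simp [hT]⟩)
      (by fun_prop) (by fun_prop)
  have ht' : (1 : ℝ) ≤ t := by exact_mod_cast ht
  have hr' : (1 : ℝ) ≤ r := by exact_mod_cast hr
  let B : Set ((Fin t → ℝ) × (Fin r → ℝ)) :=
    (⋂ m ∈ Finset.range (r + 1), {p | psum p.2 m ≤ 1 - psum p.1 t}) ∩
      {p | -psum p.1 t ≤ psum p.2 r}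
  have hB : MeasurableSet B :=
    (Finset.measurableSet_biInter _ fun m _ => measurableSet_le (by fun_prop) (by fun_prop)).inter
      (measurableSet_le (by fun_prop) (by fun_prop))
  have hsec : ∀ z ∈ ballot t 1 (h + 1),
      (stdNormal r).real (Prod.mk z ⁻¹' B) ≤ 27 * (h + 3) / (r * √r) := by
    rintro z ⟨hz1, hz2⟩
    have e : Prod.mk z ⁻¹' B = ballot r (1 - psum z t) 1 := by
      ext v; simp [B, ballot, sub_eq_add_neg]
    have hz0 := hz1 t le_rfl
    rw [e]
    refine (measureReal_ballot_le hr (a := 1 - psum z t) (h := 1) (by linarith)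
      (by norm_num)).trans ?_
    refine div_le_div_of_nonneg_right ?_ (by positivity)
    linarith
  have hmain := measure_inter_le_of_indepFun hZ.aemeasurable hV hind
    (measurableSet_ballot t 1 (h + 1)) hB (κ := 27 * (h + 3) / (r * √r)) (by positivity) hsec
  have hA : (stdNormal (t + r)).real {x | Z x ∈ ballot t 1 (h + 1)} ≤
      (h + 3) ^ 3 * 3 / (t * √t) := by
    rw [hZ.measureReal_eq (p := fun y => y ∈ ballot t 1 (h + 1)) (measurableSet_ballot _ _ _)]
    refine (measureReal_ballot_le ht (a := 1) (h := h + 1) (by norm_num) (by linarith)).trans_eq ?_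
    ring
  calc _ ≤ _ := by
        refine measureReal_mono ?_ (by finiteness)
        rintro x ⟨⟨hx1, hx2⟩, hx3⟩
        have hZt : ∀ m ≤ t, psum (Z x) m = psum x m := fun m hm => psum_castAdd x hm
        refine ⟨⟨fun m hm => ?_, ?_⟩, ?_⟩
        · rw [hZt m hm]; exact hx1 m (by omega)
        · rw [hZt t le_rfl]; linarith
        · simp only [B, mem_inter_iff, mem_iInter, Finset.mem_range, mem_ofPred_eq, hZt t le_rfl]
          refine ⟨fun m hm => ?_, ?_⟩
          · have := hx1 (t + m) (by omega)
            rw [psum_add] at this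
            simp only [V]; linarith
          · rw [psum_add] at hx2
            simp only [V]; linarith
    _ ≤ _ := hmain
    _ ≤ (h + 3) ^ 3 * 3 / (t * √t) * (27 * (h + 3) / (r * √r)) := by gcongr
    _ = _ := by rw [div_mul_div_comm]; ring

/-! ### The dipped barrier and the slope -/

theorem summable_log_pow_div :
    Summable fun k : ℕ => (4 * Real.log k + 3) ^ 4 / ((k : ℝ) * √k) := by
  have hs : Summable fun k : ℕ => (67 : ℝ) ^ 4 * (k : ℝ) ^ (-(5 / 4) : ℝ) :=
    (Real.summable_nat_rpow.2 (by norm_num)).mul_left _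
  refine hs.of_nonneg_of_le (fun k => by positivity) fun k => ?_
  rcases Nat.eq_zero_or_pos k with rfl | hk
  · simp
  have hk1 : (1 : ℝ) ≤ k := by exact_mod_cast hk
  have hk0 : (0 : ℝ) < k := by linarith
  have h1 : Real.log k ≤ 16 * (k : ℝ) ^ (1 / 16 : ℝ) := by
    have := Real.log_le_rpow_div hk0.le (show (0 : ℝ) < 1 / 16 by norm_num)
    linarith
  have h2 : (1 : ℝ) ≤ (k : ℝ) ^ (1 / 16 : ℝ) := Real.one_le_rpow hk1 (by norm_num)
  have h3 : (4 * Real.log k + 3) ^ 4 ≤ (67 * (k : ℝ) ^ (1 / 16 : ℝ)) ^ 4 := by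
    have := Real.log_nonneg hk1
    gcongr
    linarith
  have h4 : (k : ℝ) * √k = (k : ℝ) ^ (3 / 2 : ℝ) := by
    rw [Real.sqrt_eq_rpow, ← Real.rpow_one_add' hk0.le (by norm_num)]
    norm_num
  have h5 : (67 * (k : ℝ) ^ (1 / 16 : ℝ)) ^ 4 = 67 ^ 4 * (k : ℝ) ^ (1 / 4 : ℝ) := by
    rw [mul_pow, ← Real.rpow_natCast ((k : ℝ) ^ (1 / 16 : ℝ)), ← Real.rpow_mul hk0.le]
    norm_num
  rw [h4, div_le_iff₀ (by positivity), mul_assoc, ← Real.rpow_add hk0]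
  rw [h5] at h3
  norm_num at h3 ⊢
  exact h3

theorem exists_tail_log_pow_div_le {ε : ℝ} (hε : 0 < ε) :
    ∃ K : ℕ, 1 ≤ K ∧ ∀ F : Finset ℕ, (∀ k ∈ F, K ≤ k) →
      ∑ k ∈ F, (4 * Real.log k + 3) ^ 4 / ((k : ℝ) * √k) ≤ ε := by
  obtain ⟨s, hs⟩ := summable_iff_vanishing_norm.1 summable_log_pow_div ε hε
  refine ⟨s.sup id + 1, by omega, fun F hF => ?_⟩
  refine (le_abs_self _).trans (hs F ?_).le
  rw [Finset.disjoint_left]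
  intro k hk hks
  have h1 := hF k hk
  have h2 : k ≤ s.sup id := Finset.le_sup (f := id) hks
  omega

/-- The walks of length `L` that never exceed `1`, end in `[0, 1]`, and at each time `m` at distance
`d ≥ K` from `{0, L}` are below `-4 log d`. The logarithmic dip is much smaller than the typical
distance `√d` of a conditioned walk from the barrier, so it costs only a constant factor. -/
def barrier (L K : ℕ) : Set (Fin L → ℝ) :=
  {y | y ∈ ballot L 1 1 ∧
    ∀ m, K ≤ m → m + K ≤ L → psum y m ≤ -(4 * Real.log (min m (L - m) : ℕ))}

theorem measurableSet_barrier (L K : ℕ) : MeasurableSet (barrier L K) := by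
  have : barrier L K = ballot L 1 1 ∩
      ⋂ m ∈ (Finset.range (L + 1)).filter fun m => K ≤ m ∧ m + K ≤ L,
      {y | psum y m ≤ -(4 * Real.log (min m (L - m) : ℕ))} := by
    ext y
    simp only [barrier, mem_ofPred_eq, mem_inter_iff, mem_iInter, Finset.mem_filter,
      Finset.mem_range]
    refine and_congr_right fun _ => ⟨fun h m hm => h m hm.2.1 hm.2.2, fun h m h1 h2 => ?_⟩
    exact h m ⟨by omega, h1, h2⟩
  rw [this]
  exact (measurableSet_ballot L 1 1).inter
    (Finset.measurableSet_biInter _ fun m _ => measurableSet_le (by fun_prop) (by fun_prop))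

theorem mul_sqrt_le_of_le_two_mul {x y : ℝ} (hx : 0 ≤ x) (hxy : x ≤ 2 * y) :
    x * √x ≤ 3 * (y * √y) := by
  have hy : 0 ≤ y := by linarith
  have h1 : √x ≤ 3 / 2 * √y := by
    rw [Real.sqrt_le_left (by positivity), mul_pow, Real.sq_sqrt hy]
    linarith
  calc x * √x ≤ 2 * y * (3 / 2 * √y) := by gcongr
    _ = _ := by ring

/-- Failing the dip at time `t` costs a factor that is summable over the distances of `t` to the two
endpoints. -/
theorem measureReal_dip_le {t r : ℕ} (ht : 1 ≤ t) (hr : 1 ≤ r) :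
    (stdNormal (t + r)).real {x | x ∈ ballot (t + r) 1 1 ∧
      -(4 * Real.log (min t r : ℕ)) ≤ psum x t} ≤
      243 / ((t + r : ℕ) * √(t + r : ℕ)) * ((4 * Real.log t + 3) ^ 4 / ((t : ℝ) * √t) +
        (4 * Real.log r + 3) ^ 4 / ((r : ℝ) * √r)) := by
  have ht' : (1 : ℝ) ≤ t := by exact_mod_cast ht
  have hr' : (1 : ℝ) ≤ r := by exact_mod_cast hr
  have hk : 1 ≤ min t r := le_min ht hr
  have hk' : (1 : ℝ) ≤ (min t r : ℕ) := by exact_mod_cast hk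
  refine (measureReal_ballot_inter_le ht hr
    (mul_nonneg zero_le_four (Real.log_nonneg hk'))).trans ?_
  have hL : (1 : ℝ) ≤ (t + r : ℕ) := by push_cast; linarith
  have main : ∀ k l : ℝ, 1 ≤ k → 1 ≤ l → ((t + r : ℕ) : ℝ) ≤ 2 * l → ∀ c : ℝ, 0 ≤ c →
      81 * c / ((k * √k) * (l * √l)) ≤
        243 / ((t + r : ℕ) * √(t + r : ℕ)) * (c / (k * √k)) := by
    intro k l hk hl hl2 c hc
    have h := mul_sqrt_le_of_le_two_mul (by linarith) hl2
    have h1 : (0 : ℝ) < (t + r : ℕ) * √(t + r : ℕ) := by positivity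
    have h2 : 0 < k * √k := by positivity
    have h3 : 0 < l * √l := by positivity
    rw [div_mul_div_comm, div_le_div_iff₀ (by positivity) (by positivity)]
    have h4 : 0 ≤ 81 * c * (k * √k) := by positivity
    nlinarith [mul_le_mul_of_nonneg_left h h4]
  have hgt : 0 ≤ (4 * Real.log t + 3) ^ 4 / ((t : ℝ) * √t) := by positivity
  have hgr : 0 ≤ (4 * Real.log r + 3) ^ 4 / ((r : ℝ) * √r) := by positivity
  have hc : (0 : ℝ) ≤ 243 / ((t + r : ℕ) * √(t + r : ℕ)) := by positivity
  rcases le_total t r with h | h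
  · rw [min_eq_left h]
    have h' : (t : ℝ) ≤ r := by exact_mod_cast h
    have := main t r ht' hr' (by push_cast; linarith) ((4 * Real.log t + 3) ^ 4) (by positivity)
    nlinarith
  · rw [min_eq_right h]
    have h' : (r : ℝ) ≤ t := by exact_mod_cast h
    have := main r t hr' ht' (by push_cast; linarith) ((4 * Real.log r + 3) ^ 4) (by positivity)
    rw [mul_comm ((r : ℝ) * √r)] at this
    nlinarith

/-- The dip costs at most half of the ballot probability, if `K` is large. -/
theorem exists_measureReal_barrier_ge :
    ∃ K : ℕ, 1 ≤ K ∧ ∀ L : ℕ, 1 ≤ L →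
      1 / (10 * (L * √L)) ≤ (stdNormal L).real (barrier L K) := by
  -- With `ε = 1 / 4860` the two tails add up to at most `2 ε`, and `243 * 2 ε = 1 / 10` is half of
  -- the constant `1 / 5` of the lower ballot estimate.
  obtain ⟨K, hK, hsum⟩ := exists_tail_log_pow_div_le (show (0 : ℝ) < 1 / 4860 by norm_num)
  refine ⟨K, hK, fun L hL => ?_⟩
  have hL' : (1 : ℝ) ≤ L := by exact_mod_cast hL
  let F : Finset ℕ := (Finset.range (L + 1)).filter fun m => K ≤ m ∧ m + K ≤ L
  have hF : ∀ m ∈ F, K ≤ m ∧ m + K ≤ L := fun m hm => (Finset.mem_filter.1 hm).2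
  let g : ℕ → ℝ := fun k => (4 * Real.log k + 3) ^ 4 / ((k : ℝ) * √k)
  let V : ℕ → Set (Fin L → ℝ) := fun m =>
    {x | x ∈ ballot L 1 1 ∧ -(4 * Real.log (min m (L - m) : ℕ)) ≤ psum x m}
  have hV : ∀ m ∈ F, (stdNormal L).real (V m) ≤ 243 / (L * √L) * (g m + g (L - m)) := by
    intro m hm
    obtain ⟨h1, h2⟩ := hF m hm
    obtain ⟨r, rfl⟩ : ∃ r, L = m + r := ⟨L - m, by omega⟩
    have := measureReal_dip_le (t := m) (r := r) (by omega) (by omega)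
    simpa only [V, g, Nat.add_sub_cancel_left] using this
  have hsub : ballot L 1 1 ⊆ barrier L K ∪ ⋃ m ∈ F, V m := by
    intro x hx
    by_cases h : x ∈ barrier L K
    · exact Or.inl h
    · right
      simp only [barrier, mem_ofPred_eq, hx, true_and, not_forall] at h
      obtain ⟨m, h1, h2, h3⟩ := h
      simp only [mem_iUnion]
      refine ⟨m, ?_, hx, (not_le.1 h3).le⟩
      simp only [F, Finset.mem_filter, Finset.mem_range]
      omega
  have h1 := measureReal_ballot_one_ge hL
  have h2 := (measureReal_mono hsub (measure_ne_top _ _)).trans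
    (measureReal_union_le (μ := stdNormal L) _ _)
  have h3 := measureReal_biUnion_finset_le (μ := stdNormal L) F V
  have h4 := Finset.sum_le_sum hV
  rw [← Finset.mul_sum, Finset.sum_add_distrib] at h4
  have h5 : ∑ m ∈ F, g m ≤ 1 / 4860 := hsum F fun m hm => (hF m hm).1
  have h6 : ∑ m ∈ F, g (L - m) ≤ 1 / 4860 := by
    have hinj : Set.InjOn (fun m => L - m) (F : Set ℕ) := by
      intro a ha b hb hab
      have := hF a ha
      have := hF b hb
      simp only at hab; omega
    rw [← Finset.sum_image (f := g) hinj]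
    refine hsum _ fun k hk => ?_
    obtain ⟨m, hm, rfl⟩ := Finset.mem_image.1 hk
    have := hF m hm
    omega
  have h7 : (243 : ℝ) / (L * √L) * (∑ m ∈ F, g m + ∑ m ∈ F, g (L - m)) ≤
      243 / (L * √L) * (2 / 4860) := mul_le_mul_of_nonneg_left (by linarith) (by positivity)
  have h8 : (243 : ℝ) / (L * √L) * (2 / 4860) = 1 / (10 * (L * √L)) := by
    rw [div_mul_div_comm, div_eq_div_iff (by positivity) (by positivity)]; ring
  have h9 : (1 : ℝ) / (5 * (L * √L)) = 1 / (10 * (L * √L)) + 1 / (10 * (L * √L)) := by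
    field_simp; norm_num
  linarith

/-- The slope of the path to the maximum of a field with `L` levels: `L * slope L` is the centring
`2 √(log 2) L - (3 / (4 √(log 2))) log L`. -/
noncomputable def slope (L : ℕ) : ℝ :=
  2 * √(Real.log 2) - 3 / (4 * √(Real.log 2)) * (Real.log L / L)

theorem sqrt_log_two_bounds : 4 / 5 ≤ √(Real.log 2) ∧ √(Real.log 2) ≤ 1 := by
  have h1 := Real.log_two_gt_d9
  have h2 := Real.log_two_lt_d9
  refine ⟨Real.le_sqrt_of_sq_le (by norm_num; linarith), ?_⟩
  rw [Real.sqrt_le_left (by norm_num)]; linarith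

theorem log_div_self_bounds {L : ℕ} (hL : 1 ≤ L) :
    0 ≤ Real.log L / L ∧ Real.log L / L ≤ 1 / 2 := by
  have hL' : (1 : ℝ) ≤ L := by exact_mod_cast hL
  refine ⟨div_nonneg (Real.log_nonneg hL') (by linarith), ?_⟩
  rw [div_le_iff₀ (by linarith)]
  have h1 := Real.log_le_sub_one_of_pos (show (0 : ℝ) < L / 2 by linarith)
  rw [Real.log_div (by linarith) (by norm_num)] at h1
  have h2 := Real.log_two_lt_d9
  linarith

theorem slope_bounds {L : ℕ} (hL : 1 ≤ L) : 1 ≤ slope L ∧ slope L ≤ 2 := by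
  obtain ⟨h1, h2⟩ := sqrt_log_two_bounds
  obtain ⟨h3, h4⟩ := log_div_self_bounds hL
  have h5 : 3 / (4 * √(Real.log 2)) ≤ 15 / 16 := by
    rw [div_le_iff₀ (by linarith)]; linarith
  have h6 : 0 ≤ 3 / (4 * √(Real.log 2)) := by positivity
  have h7 := mul_le_mul h5 h4 h3 (by norm_num)
  have h8 := mul_nonneg h6 h3
  unfold slope
  constructor <;> linarith

theorem slope_sq (L : ℕ) : slope L ^ 2 = 4 * Real.log 2 - 3 * (Real.log L / L) +
    9 / (16 * Real.log 2) * (Real.log L / L) ^ 2 := by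
  have h0 : 0 < √(Real.log 2) := by linarith [sqrt_log_two_bounds.1]
  have h1 : √(Real.log 2) ^ 2 = Real.log 2 := Real.sq_sqrt (Real.log_nonneg (by norm_num))
  have h2 : 0 < Real.log 2 := Real.log_pos (by norm_num)
  unfold slope
  generalize √(Real.log 2) = s at h0 h1
  rw [← h1]
  field_simp
  ring

theorem mul_sqrt_eq_exp {x : ℝ} (hx : 0 < x) : x * √x = Real.exp (3 / 2 * Real.log x) := by
  rw [Real.sqrt_eq_rpow, ← Real.rpow_one_add' hx.le (by norm_num), Real.rpow_def_of_pos hx]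
  congr 1; ring

theorem one_div_four_pow_eq_exp (r : ℕ) :
    ((1 : ℝ) / 4) ^ r = Real.exp (-(2 * Real.log 2 * r)) := by
  rw [show (1 : ℝ) / 4 = Real.exp (-(2 * Real.log 2)) by
    rw [Real.exp_neg, mul_comm, Real.exp_mul, Real.exp_log (by norm_num)]; norm_num,
    ← Real.exp_nat_mul]
  congr 1; ring

/-- The logarithmic correction in `slope L` makes up for the factor `L ^ (-3 / 2)` of the ballot
estimate. -/
theorem exp_neg_slope_sq_ge {L : ℕ} (hL : 1 ≤ L) :
    Real.exp (-2) * (L * √L) * (1 / 4) ^ L ≤ Real.exp (-(L * slope L ^ 2 / 2)) := by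
  have hL' : (1 : ℝ) ≤ L := by exact_mod_cast hL
  have hL0 : (0 : ℝ) < L := by linarith
  rw [mul_sqrt_eq_exp hL0, one_div_four_pow_eq_exp, ← Real.exp_add, ← Real.exp_add,
    Real.exp_le_exp, slope_sq]
  have h1 : Real.log L ^ 2 ≤ 4 * L := by
    have h2 := Real.log_le_sub_one_of_pos (Real.sqrt_pos.2 hL0)
    rw [Real.log_sqrt hL0.le] at h2
    have h3 := Real.log_nonneg hL'
    have h4 : Real.log L ≤ 2 * √L := by linarith
    calc Real.log L ^ 2 ≤ (2 * √(L : ℝ)) ^ 2 := by gcongr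
      _ = 4 * (L : ℝ) := by rw [mul_pow, Real.sq_sqrt hL0.le]; ring
  have h2 : 9 / (16 * Real.log 2) ≤ 1 := by
    have := Real.log_two_gt_d9
    rw [div_le_one (by linarith)]; linarith
  have h3 : (L : ℝ) * (Real.log L / L) ^ 2 ≤ 4 := by
    rw [div_pow, ← mul_div_assoc, div_le_iff₀ (by positivity)]
    nlinarith
  have h4 : (0 : ℝ) ≤ L * (Real.log L / L) ^ 2 := by positivity
  have h5 : 9 / (16 * Real.log 2) * (L * (Real.log L / L) ^ 2) ≤ 1 * 4 :=
    mul_le_mul h2 h3 h4 (by norm_num)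
  have h6 : (L : ℝ) * (Real.log L / L) = Real.log L := by field_simp
  nlinarith

/-- Over `r ≤ L` steps the correction gains at most a factor of order `r ^ (3 / 2)`, because
`log L / L ≤ (log r + 1) / r`. -/
theorem exp_neg_slope_sq_le {L r : ℕ} (hr : 1 ≤ r) (hrL : r ≤ L) :
    Real.exp (-(r * slope L ^ 2 / 2)) ≤ Real.exp (3 / 2) * (r * √r) * (1 / 4) ^ r := by
  have hr' : (1 : ℝ) ≤ r := by exact_mod_cast hr
  have hrL' : (r : ℝ) ≤ L := by exact_mod_cast hrL
  have hr0 : (0 : ℝ) < r := by linarith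
  have hL0 : (0 : ℝ) < L := by linarith
  rw [mul_sqrt_eq_exp hr0, one_div_four_pow_eq_exp, ← Real.exp_add, ← Real.exp_add,
    Real.exp_le_exp, slope_sq]
  have h1 : (r : ℝ) * (Real.log L / L) ≤ Real.log r + 1 := by
    have h2 := Real.log_le_sub_one_of_pos (show (0 : ℝ) < L / r by positivity)
    rw [Real.log_div hL0.ne' hr0.ne'] at h2
    have h3 := Real.log_nonneg hr'
    rw [mul_div_assoc', div_le_iff₀ hL0]
    have h4 : r * Real.log L ≤ r * (Real.log r + (L / r - 1)) :=
      mul_le_mul_of_nonneg_left (by linarith) hr0.le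
    have h5 : (r : ℝ) * (L / r) = L := by field_simp
    nlinarith [mul_le_mul_of_nonneg_right hrL' h3]
  have h2 : 0 ≤ 9 / (16 * Real.log 2) * (Real.log L / L) ^ 2 := by
    have := Real.log_pos (show (1 : ℝ) < 2 by norm_num)
    positivity
  have h3 := mul_nonneg hr0.le h2
  nlinarith

/-! ### The second moment method for correlated walks -/

/-- The walks whose fluctuation around the line of slope `slope L` lies in `barrier L K`. -/
def goodSet (L K : ℕ) : Set (Fin L → ℝ) := {x | (fun i => x i - slope L) ∈ barrier L K}

theorem measurableSet_goodSet (L K : ℕ) : MeasurableSet (goodSet L K) := by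
  have h : Measurable fun (x : Fin L → ℝ) i => x i - slope L := by fun_prop
  exact h (measurableSet_barrier L K)

theorem psum_sub_const {r : ℕ} (x : Fin r → ℝ) (β : ℝ) :
    psum (fun i => x i - β) r = psum x r - r * β := by
  simp [psum_self]

theorem le_sum_of_mem_goodSet {L K : ℕ} {x : Fin L → ℝ} (hx : x ∈ goodSet L K) :
    L * slope L ≤ ∑ i, x i := by
  have h := hx.1.2
  rw [psum_sub_const, psum_self] at h
  linarith

/-- One walk is good with probability of order `4 ^ (-L)`. -/
theorem exists_measureReal_goodSet_ge :
    ∃ K : ℕ, 1 ≤ K ∧ ∀ L : ℕ, 1 ≤ L →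
      Real.exp (-4) / 10 * (1 / 4) ^ L ≤ (stdNormal L).real (goodSet L K) := by
  obtain ⟨K, hK, h⟩ := exists_measureReal_barrier_ge
  refine ⟨K, hK, fun L hL => ?_⟩
  have hL' : (1 : ℝ) ≤ L := by exact_mod_cast hL
  obtain ⟨hβ1, hβ2⟩ := slope_bounds hL
  have h1 := stdNormal_real_shift_ge (r := L) (β := slope L) (c := 1) (by linarith)
    (measurableSet_barrier L K) fun y hy => hy.1.1 L le_rfl
  refine le_trans ?_ h1
  have h2 : Real.exp (-2) * (Real.exp (-2) * (L * √L) * (1 / 4) ^ L) ≤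
      Real.exp (-slope L * 1 - L * slope L ^ 2 / 2) := by
    rw [sub_eq_add_neg, Real.exp_add]
    exact mul_le_mul (Real.exp_le_exp.2 (by linarith)) (exp_neg_slope_sq_ge hL) (by positivity)
      (Real.exp_pos _).le
  calc _ = Real.exp (-2) * (Real.exp (-2) * (L * √L) * (1 / 4) ^ L) * (1 / (10 * (L * √L))) := by
        rw [show (-4 : ℝ) = -2 + -2 by norm_num, Real.exp_add]
        field_simp
    _ ≤ _ := mul_le_mul h2 (h L hL) (by positivity) (Real.exp_pos _).le

theorem exp_neg_mul_add_two_le {a β : ℝ} (ha : 0 ≤ a) (hβ1 : 1 ≤ β) (hβ2 : β ≤ 2) :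
    Real.exp (-β * (a - 1)) * (a + 2) ≤ 2 * Real.exp 2 * Real.exp (-(a / 2)) := by
  have h1 : a / 2 + 1 ≤ Real.exp (a / 2) := Real.add_one_le_exp _
  have h2 : Real.exp (-β * (a - 1)) ≤ Real.exp 2 * Real.exp (-a) := by
    rw [← Real.exp_add, Real.exp_le_exp]; nlinarith
  have h3 : Real.exp (-a) * Real.exp (a / 2) = Real.exp (-(a / 2)) := by
    rw [← Real.exp_add]; congr 1; ring
  calc _ ≤ Real.exp 2 * Real.exp (-a) * (2 * Real.exp (a / 2)) :=
        mul_le_mul h2 (by linarith) (by linarith) (by positivity)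
    _ = _ := by rw [← h3]; ring

/-- The last `r` steps of a walk below the barrier with slope `slope L`, starting at distance `a`
below the barrier. -/
theorem measureReal_final_steps_le {L r : ℕ} (hr : 1 ≤ r) (hrL : r ≤ L) {a : ℝ} (ha : 0 ≤ a) :
    (stdNormal r).real {v | (fun i => v i - slope L) ∈ ballot r a 1} ≤
      54 * Real.exp 4 * (1 / 4) ^ r * Real.exp (-(a / 2)) := by
  obtain ⟨hβ1, hβ2⟩ := slope_bounds (hr.trans hrL)
  have hr' : (1 : ℝ) ≤ r := by exact_mod_cast hr
  have hr0 : (0 : ℝ) < r := by linarith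
  refine (stdNormal_real_shift_le (β := slope L) (c := a - 1) (by linarith)
    (measurableSet_ballot r a 1) fun y hy => hy.2).trans ?_
  have h1 := measureReal_ballot_le hr ha (show (0 : ℝ) ≤ 1 by norm_num)
  have h2 := exp_neg_slope_sq_le hr hrL
  have h3 := exp_neg_mul_add_two_le ha hβ1 hβ2
  rw [sub_eq_add_neg (-slope L * _), Real.exp_add]
  calc _ ≤ Real.exp (-slope L * (a - 1)) * (Real.exp (3 / 2) * (r * √r) * (1 / 4) ^ r) *
        ((1 + 2) ^ 3 * (a + 2) / (r * √r)) := by gcongr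
    _ = 27 * Real.exp (3 / 2) * (1 / 4) ^ r * (Real.exp (-slope L * (a - 1)) * (a + 2)) := by
        field_simp; norm_num
    _ ≤ 27 * Real.exp 2 * (1 / 4) ^ r * (2 * Real.exp 2 * Real.exp (-(a / 2))) := by
        gcongr; norm_num
    _ = _ := by
        rw [show (4 : ℝ) = 2 + 2 by norm_num, Real.exp_add]; ring

/-- A dip of `4 log d` gains the factor `d ^ (-2)`; the constant `(K + 1) ^ 2` covers the times near
the endpoints, where no dip is asked for. -/
theorem exp_neg_half_le_of_dip {t r K : ℕ} (ht : 1 ≤ t) (hr : 1 ≤ r) {a : ℝ} (ha : 0 ≤ a)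
    (hdip : K ≤ t → K ≤ r → 4 * Real.log (min t r : ℕ) ≤ a) :
    Real.exp (-(a / 2)) ≤ (K + 1) ^ 2 / (min t r : ℕ) ^ 2 := by
  have hk : 1 ≤ min t r := le_min ht hr
  set k := min t r
  have hk' : (1 : ℝ) ≤ k := by exact_mod_cast hk
  have hK : (0 : ℝ) ≤ K := Nat.cast_nonneg K
  rw [le_div_iff₀ (by positivity)]
  by_cases h : K ≤ k
  · have h1 := hdip (h.trans (min_le_left _ _)) (h.trans (min_le_right _ _))
    have h2 : (k : ℝ) ^ 2 = Real.exp (2 * Real.log k) := by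
      rw [mul_comm, Real.exp_mul, Real.exp_log (by linarith)]; norm_num
    rw [h2, ← Real.exp_add]
    have h3 : Real.exp (-(a / 2) + 2 * Real.log k) ≤ 1 := Real.exp_le_one_iff.2 (by linarith)
    nlinarith
  · have h1 : (k : ℝ) ≤ K := by exact_mod_cast (not_le.1 h).le
    have h2 : Real.exp (-(a / 2)) ≤ 1 := Real.exp_le_one_iff.2 (by linarith)
    have h3 : (0 : ℝ) ≤ (k : ℝ) ^ 2 := by positivity
    nlinarith

/-- Decoupling: if the last `r` steps of the walk `X` are independent of its first `t` steps and of
an event, then the event and the good event for `X` occur together with at most the probability of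
the event times the cost of the last `r` steps, started from the dip. The cost of the first `t`
steps is dropped, so that their correlation with the event plays no role; the dip supplies the
summable factor `1 / min t r ^ 2`. -/
theorem measureReal_inter_goodSet_le {Ω α : Type*} [MeasurableSpace Ω] [MeasurableSpace α]
    {P : Measure Ω} [IsProbabilityMeasure P] {t r K : ℕ} (ht : 1 ≤ t) (hr : 1 ≤ r)
    {Z : Ω → α} (hZ : Measurable Z) {X : Ω → Fin (t + r) → ℝ} (hX : Measurable X)
    (hlaw : HasLaw X (stdNormal (t + r)) P)
    (hind : IndepFun (fun ω => (Z ω, fun i => X ω (Fin.castAdd r i)))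
      (fun ω i => X ω (Fin.natAdd t i)) P)
    {A : Set α} (hA : MeasurableSet A) :
    P.real {ω | Z ω ∈ A ∧ X ω ∈ goodSet (t + r) K} ≤
      P.real {ω | Z ω ∈ A} *
        (54 * Real.exp 4 * (1 / 4) ^ r * ((K + 1) ^ 2 / (min t r : ℕ) ^ 2)) := by
  set β := slope (t + r)
  let pos : (Fin t → ℝ) → ℝ := fun c => psum (fun i => c i - β) t
  have hpos : Measurable pos :=
    (measurable_psum t).comp (by fun_prop : Measurable fun (c : Fin t → ℝ) i => c i - β)
  have hV : HasLaw (fun ω i => X ω (Fin.natAdd t i)) (stdNormal r) P :=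
    (hasLaw_stdNormal_comp (Fin.natAdd_injective r t)).comp hlaw
  let D : Set ℝ := if K ≤ t ∧ K ≤ r then Iic (-(4 * Real.log (min t r : ℕ))) else univ
  have hD : MeasurableSet D := by
    simp only [D]; split_ifs
    exacts [measurableSet_Iic, MeasurableSet.univ]
  let A' : Set (α × (Fin t → ℝ)) := {p | p.1 ∈ A ∧ pos p.2 ≤ 1 ∧ pos p.2 ∈ D}
  have hA' : MeasurableSet A' :=
    (measurable_fst hA).inter ((measurableSet_le (hpos.comp measurable_snd) measurable_const).inter
      ((hpos.comp measurable_snd) hD))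
  let w : (Fin r → ℝ) → ℕ → ℝ := fun v m => psum (fun i => v i - β) m
  have hw : ∀ m, Measurable fun v => w v m := fun m =>
    (measurable_psum m).comp (by fun_prop : Measurable fun (c : Fin r → ℝ) i => c i - β)
  let B : Set ((α × (Fin t → ℝ)) × (Fin r → ℝ)) :=
    (⋂ m ∈ Finset.range (r + 1), {p | w p.2 m ≤ 1 - pos p.1.2}) ∩ {p | -pos p.1.2 ≤ w p.2 r}
  have hpos' : Measurable fun p : (α × (Fin t → ℝ)) × (Fin r → ℝ) => pos p.1.2 :=
    hpos.comp (measurable_snd.comp measurable_fst)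
  have hB : MeasurableSet B :=
    (Finset.measurableSet_biInter _ fun m _ =>
      measurableSet_le ((hw m).comp measurable_snd) (measurable_const.sub hpos')).inter
      (measurableSet_le hpos'.neg ((hw r).comp measurable_snd))
  have hsec : ∀ z ∈ A', (stdNormal r).real (Prod.mk z ⁻¹' B) ≤
      54 * Real.exp 4 * (1 / 4) ^ r * ((K + 1) ^ 2 / (min t r : ℕ) ^ 2) := by
    rintro ⟨z, c⟩ ⟨-, h1, h2⟩
    simp only at h1 h2
    have e : Prod.mk (z, c) ⁻¹' B = {v | (fun i => v i - β) ∈ ballot r (1 - pos c) 1} := by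
      ext v; simp [B, ballot, w, sub_eq_add_neg]
    rw [e]
    refine (measureReal_final_steps_le hr (by omega) (by linarith)).trans ?_
    refine mul_le_mul_of_nonneg_left (exp_neg_half_le_of_dip ht hr (by linarith) ?_) (by positivity)
    intro h3 h4
    simp only [D, h3, h4, and_self, if_true, mem_Iic] at h2
    linarith
  refine (measureReal_mono ?_ (measure_ne_top _ _)).trans ((measure_inter_le_of_indepFun
    (hZ.prodMk (by fun_prop)).aemeasurable hV hind hA' hB (by positivity) hsec).trans ?_)
  · rintro ω ⟨hω, ⟨hx1, hx2⟩, hx3⟩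
    have e1 : ∀ m ≤ t, psum (fun i : Fin t => X ω (Fin.castAdd r i) - β) m =
        psum (fun i => X ω i - β) m := fun m hm => psum_castAdd (fun i => X ω i - β) hm
    have e2 : ∀ m, psum (fun i => X ω i - β) (t + m) =
        pos (fun i => X ω (Fin.castAdd r i)) + w (fun i => X ω (Fin.natAdd t i)) m := by
      intro m
      rw [psum_add, ← e1 t le_rfl]
    have e3 : psum (fun i => X ω i - β) t = pos (fun i => X ω (Fin.castAdd r i)) :=
      (e1 t le_rfl).symm
    refine ⟨⟨hω, ?_, ?_⟩, ?_, ?_⟩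
    · simp only; rw [← e3]; exact hx1 t (by omega)
    · simp only [D]
      split_ifs with h
      · have := hx3 t h.1 (by omega)
        rw [e3, Nat.add_sub_cancel_left] at this
        exact this
      · trivial
    · simp only [mem_iInter, Finset.mem_range, mem_ofPred_eq]
      intro m hm
      have := hx1 (t + m) (by omega)
      rw [e2] at this
      linarith
    · simp only [mem_ofPred_eq]
      rw [e2] at hx2
      linarith
  · refine mul_le_mul_of_nonneg_right (measureReal_mono ?_ (measure_ne_top _ _)) (by positivity)
    rintro ω ⟨h, -⟩
    exact h

/-- The second moment method. -/
theorem sum_measureReal_le_of_sum_inter_le {Ω ι : Type*} [MeasurableSpace Ω] {P : Measure Ω}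
    [IsProbabilityMeasure P] {S : Finset ι} {E : ι → Set Ω} (hE : ∀ z ∈ S, MeasurableSet (E z))
    {C : ℝ} (hC : 0 < C)
    (h : ∀ z ∈ S, ∑ w ∈ S, P.real (E z ∩ E w) ≤ C * P.real (E z)) :
    ∑ z ∈ S, P.real (E z) ≤ C * P.real (⋃ z ∈ S, E z) := by
  set U := ⋃ z ∈ S, E z
  have hU : MeasurableSet U := Finset.measurableSet_biUnion S hE
  have hi : ∀ A : Set Ω, MeasurableSet A → Integrable (A.indicator (1 : Ω → ℝ)) P :=
    fun A hA => (integrable_const (1 : ℝ)).indicator hA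
  have hint : ∀ A : Set Ω, MeasurableSet A → ∫ ω, A.indicator (1 : Ω → ℝ) ω ∂P = P.real A :=
    fun A hA => integral_indicator_one hA
  -- With `N` the number of events that occur, `2 C N ≤ N ^ 2 + C ^ 2` where `N > 0`.
  have hpt : ∀ ω, 2 * C * ∑ z ∈ S, (E z).indicator (1 : Ω → ℝ) ω ≤
      (∑ z ∈ S, ∑ w ∈ S, (E z ∩ E w).indicator (1 : Ω → ℝ) ω) +
        C ^ 2 * U.indicator (1 : Ω → ℝ) ω := by
    intro ω
    have h1 : ∑ z ∈ S, ∑ w ∈ S, (E z ∩ E w).indicator (1 : Ω → ℝ) ω =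
        (∑ z ∈ S, (E z).indicator (1 : Ω → ℝ) ω) ^ 2 := by
      rw [sq, Finset.sum_mul_sum]
      refine Finset.sum_congr rfl fun z _ => Finset.sum_congr rfl fun w _ => ?_
      rw [Set.inter_indicator_one]; rfl
    rw [h1]
    by_cases hω : ω ∈ U
    · rw [indicator_of_mem hω, Pi.one_apply]
      nlinarith [sq_nonneg (∑ z ∈ S, (E z).indicator (1 : Ω → ℝ) ω - C)]
    · have : ∑ z ∈ S, (E z).indicator (1 : Ω → ℝ) ω = 0 := by
        refine Finset.sum_eq_zero fun z hz => indicator_of_notMem (fun hzω => hω ?_) _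
        exact mem_biUnion hz hzω
      rw [this, indicator_of_notMem hω]; simp
  have hmono := integral_mono (μ := P)
    ((integrable_finsetSum S fun z hz => hi _ (hE z hz)).const_mul (2 * C))
    ((integrable_finsetSum S fun z hz => integrable_finsetSum S fun w hw =>
      hi _ ((hE z hz).inter (hE w hw))).add ((hi U hU).const_mul (C ^ 2))) hpt
  rw [integral_const_mul, integral_finsetSum S fun z hz => hi _ (hE z hz)] at hmono
  simp only [Pi.add_apply] at hmono
  rw [integral_add (integrable_finsetSum S fun z hz => integrable_finsetSum S fun w hw =>
      hi _ ((hE z hz).inter (hE w hw))) ((hi U hU).const_mul (C ^ 2)), integral_const_mul,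
    integral_finsetSum S fun z hz => integrable_finsetSum S fun w hw =>
      hi _ ((hE z hz).inter (hE w hw)), hint U hU,
    Finset.sum_congr rfl fun z hz => hint (E z) (hE z hz),
    Finset.sum_congr rfl fun z hz => integral_finsetSum S fun w hw =>
      hi _ ((hE z hz).inter (hE w hw)),
    Finset.sum_congr rfl fun z hz => Finset.sum_congr rfl fun w hw =>
      hint (E z ∩ E w) ((hE z hz).inter (hE w hw))] at hmono
  have h2 := Finset.sum_le_sum h
  rw [← Finset.mul_sum] at h2
  have h3 : C * ∑ z ∈ S, P.real (E z) ≤ C * (C * P.real U) := by nlinarith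
  exact le_of_mul_le_mul_left h3 hC

theorem sum_inv_min_sq_le (L : ℕ) :
    ∑ r ∈ Finset.Ioo 0 L, (((min (L - r) r : ℕ) : ℝ) ^ 2)⁻¹ ≤ 4 := by
  have h1 : ∑ r ∈ Finset.Ioo 0 L, ((r : ℝ) ^ 2)⁻¹ ≤ 2 := by
    simpa using sum_Ioo_inv_sq_le (α := ℝ) 0 L
  have h2 : ∑ r ∈ Finset.Ioo 0 L, (((L - r : ℕ) : ℝ) ^ 2)⁻¹ ≤ 2 := by
    refine le_trans (le_of_eq ?_) h1
    refine Finset.sum_nbij' (fun r => L - r) (fun r => L - r) ?_ ?_ ?_ ?_ fun _ _ => rfl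
    all_goals
      intro r hr
      simp only [Finset.mem_Ioo] at hr ⊢
      omega
  calc _ ≤ ∑ r ∈ Finset.Ioo 0 L, (((r : ℝ) ^ 2)⁻¹ + (((L - r : ℕ) : ℝ) ^ 2)⁻¹) := by
        refine Finset.sum_le_sum fun r _ => ?_
        have h3 : (0 : ℝ) ≤ ((r : ℝ) ^ 2)⁻¹ := by positivity
        have h4 : (0 : ℝ) ≤ (((L - r : ℕ) : ℝ) ^ 2)⁻¹ := by positivity
        rcases min_choice (L - r) r with h | h <;> rw [h] <;> linarith
    _ ≤ 4 := by rw [Finset.sum_add_distrib]; linarith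

/-- A field of `4 ^ (L - 1)` Gaussian walks of length `L` such that, for each `r`, all but about
`4 ^ r` of the walks are independent of a given one in more than their last `r` steps exceeds the
level `L * slope L` with probability bounded below. The number `ρ z w` is the number of final steps
of the walk at `w` that are known to be independent of everything else. -/
theorem exists_measureReal_exists_le_sum_ge :
    ∃ p : ℝ, 0 < p ∧ ∀ L : ℕ, 1 ≤ L → ∀ (Ω : Type*) [MeasurableSpace Ω] (P : Measure Ω)
      [IsProbabilityMeasure P] (ι : Type) (S : Finset ι) (X : ι → Ω → Fin L → ℝ) (ρ : ι → ι → ℕ),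
      (∀ z ∈ S, Measurable (X z)) → (∀ z ∈ S, HasLaw (X z) (stdNormal L) P) →
      S.card = 4 ^ (L - 1) →
      (∀ z ∈ S, ∀ w ∈ S, ρ z w < L) →
      (∀ z ∈ S, ∀ w ∈ S, ∀ t r : ℕ, ∀ h : t + r = L, r = ρ z w →
        IndepFun (fun ω => (X z ω, fun i : Fin t => X w ω ⟨i, by omega⟩))
          (fun ω (i : Fin r) => X w ω ⟨t + i, by omega⟩) P) →
      (∀ z ∈ S, ∀ r : ℕ, (S.filter fun w => ρ z w = r).card ≤ 4 * 4 ^ r) →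
      p ≤ P.real {ω | ∃ z ∈ S, L * slope L ≤ ∑ i, X z ω i} := by
  obtain ⟨K, -, hK⟩ := exists_measureReal_goodSet_ge
  set C₁ : ℝ := 54 * Real.exp 4 * (K + 1) ^ 2
  set C : ℝ := 4 + 16 * C₁
  have hC₁ : 0 < C₁ := by positivity
  have hC : 0 < C := by positivity
  -- `exp (-4) / 40` bounds the expected number of good walks from below; `C` bounds the expected
  -- number of good walks given that one walk is good.
  refine ⟨Real.exp (-4) / 40 / C, by positivity, ?_⟩
  intro L hL Ω _ P _ ι S X ρ hX hlaw hcard hρ hind hcount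
  let E : ι → Set Ω := fun z => {ω | X z ω ∈ goodSet L K}
  have hE : ∀ z ∈ S, MeasurableSet (E z) := fun z hz => hX z hz (measurableSet_goodSet L K)
  have hPE : ∀ z ∈ S, P.real (E z) = (stdNormal L).real (goodSet L K) := fun z hz =>
    (hlaw z hz).measureReal_eq (p := fun x => x ∈ goodSet L K) (measurableSet_goodSet L K)
  have hpair : ∀ z ∈ S, ∀ w ∈ S, ∀ t r : ℕ, 1 ≤ t → 1 ≤ r → t + r = L → r = ρ z w →
      P.real (E z ∩ E w) ≤
        P.real (E z) * (C₁ * ((1 / 4) ^ r * (((min t r : ℕ) : ℝ) ^ 2)⁻¹)) := by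
    intro z hz w hw t r ht hr h hrho
    subst h
    refine (measureReal_inter_goodSet_le (K := K) ht hr (hX z hz) (hX w hw) (hlaw w hw)
      (hind z hz w hw t r rfl hrho) (measurableSet_goodSet (t + r) K)).trans_eq ?_
    simp only [E, C₁]
    ring
  have hrow : ∀ z ∈ S, ∑ w ∈ S, P.real (E z ∩ E w) ≤ C * P.real (E z) := by
    intro z hz
    have hPz : 0 ≤ P.real (E z) := measureReal_nonneg
    rw [← Finset.sum_fiberwise_of_maps_to (t := Finset.range L) (g := ρ z)
      fun w hw => Finset.mem_range.2 (hρ z hz w hw)]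
    have hcount' : ∀ r, ((S.filter fun w => ρ z w = r).card : ℝ) ≤ 4 * 4 ^ r := fun r => by
      exact_mod_cast hcount z hz r
    have h0 : ∑ w ∈ S with ρ z w = 0, P.real (E z ∩ E w) ≤ 4 * P.real (E z) := by
      refine (Finset.sum_le_card_nsmul _ _ (P.real (E z)) fun w _ =>
        measureReal_mono inter_subset_left (measure_ne_top _ _)).trans ?_
      rw [nsmul_eq_mul]
      exact mul_le_mul_of_nonneg_right (by simpa using hcount' 0) hPz
    have h1 : ∀ r ∈ Finset.Ioo 0 L, ∑ w ∈ S with ρ z w = r, P.real (E z ∩ E w) ≤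
        4 * C₁ * P.real (E z) * (((min (L - r) r : ℕ) : ℝ) ^ 2)⁻¹ := by
      intro r hr
      have hr0 := (Finset.mem_Ioo.1 hr).1
      refine (Finset.sum_le_card_nsmul _ _ (P.real (E z) * (C₁ * ((1 / 4) ^ r *
        (((min (L - r) r : ℕ) : ℝ) ^ 2)⁻¹))) fun w hw => ?_).trans ?_
      · obtain ⟨hwS, hwr⟩ := Finset.mem_filter.1 hw
        have hrL := (Finset.mem_Ioo.1 hr).2
        exact hpair z hz w hwS (L - r) r (by omega) hr0 (by omega) hwr.symm
      · rw [nsmul_eq_mul]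
        refine (mul_le_mul_of_nonneg_right (hcount' r) (by positivity)).trans_eq ?_
        have : (4 : ℝ) ^ r * (1 / 4) ^ r = 1 := by rw [← mul_pow]; norm_num
        linear_combination (4 * P.real (E z) * C₁ * (((min (L - r) r : ℕ) : ℝ) ^ 2)⁻¹) * this
    have hsplit : Finset.range L = insert 0 (Finset.Ioo 0 L) := by
      ext r; simp only [Finset.mem_range, Finset.mem_insert, Finset.mem_Ioo]; omega
    rw [hsplit, Finset.sum_insert (by simp)]
    have h2 := Finset.sum_le_sum h1
    rw [← Finset.mul_sum] at h2
    have h3 := mul_le_mul_of_nonneg_left (sum_inv_min_sq_le L)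
      (show 0 ≤ 4 * C₁ * P.real (E z) by positivity)
    simp only [C]
    linarith
  have hsum := sum_measureReal_le_of_sum_inter_le hE hC hrow
  rw [Finset.sum_congr rfl hPE, Finset.sum_const, nsmul_eq_mul, hcard] at hsum
  have hmean : Real.exp (-4) / 40 ≤ ((4 ^ (L - 1) : ℕ) : ℝ) * (stdNormal L).real (goodSet L K) := by
    obtain ⟨l, rfl⟩ : ∃ l, L = l + 1 := ⟨L - 1, by omega⟩
    refine le_trans (le_of_eq ?_) (mul_le_mul_of_nonneg_left (hK (l + 1) hL) (Nat.cast_nonneg _))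
    have : (4 : ℝ) ^ l * (1 / 4) ^ l = 1 := by rw [← mul_pow]; norm_num
    rw [Nat.add_sub_cancel, pow_succ]
    push_cast
    linear_combination (-(Real.exp (-4) / 40)) * this
  rw [div_le_iff₀ hC, mul_comm]
  refine (hmean.trans hsum).trans (mul_le_mul_of_nonneg_left ?_ hC.le)
  refine measureReal_mono (fun ω hω => ?_) (measure_ne_top _ _)
  simp only [mem_iUnion] at hω
  obtain ⟨z, hz, hzω⟩ := hω
  exact ⟨z, hz, le_sum_of_mem_goodSet hzω⟩

/-! ### The noise and the walk over the scales -/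

/-- Functions of disjoint blocks of an independent family are independent. -/
theorem indepFun_of_disjoint_blocks {Ω ι β γ : Type*} [MeasurableSpace Ω] [MeasurableSpace β]
    [MeasurableSpace γ] {P : Measure Ω} {X : ι → Ω → ℝ} (hX : ∀ i, Measurable (X i))
    (hind : iIndepFun X P) {S T : Finset ι} (hST : Disjoint S T)
    {F : (ι → ℝ) → β} {G : (ι → ℝ) → γ} (hF : Measurable F) (hG : Measurable G)
    (hFS : ∀ x y : ι → ℝ, (∀ i ∈ S, x i = y i) → F x = F y)
    (hGT : ∀ x y : ι → ℝ, (∀ i ∈ T, x i = y i) → G x = G y) :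
    IndepFun (fun ω => F fun i => X i ω) (fun ω => G fun i => X i ω) P := by
  classical
  let ext : (U : Finset ι) → (U → ℝ) → ι → ℝ := fun U y i => if h : i ∈ U then y ⟨i, h⟩ else 0
  have hext : ∀ U, Measurable (ext U) := by
    intro U
    refine measurable_pi_lambda _ fun i => ?_
    by_cases h : i ∈ U
    · simp only [ext, h, dite_true]; fun_prop
    · simp only [ext, h, dite_false]; fun_prop
  have h := (hind.indepFun_finset S T hST hX).comp (hF.comp (hext S)) (hG.comp (hext T))
  convert h using 1
  · ext ω
    exact hFS _ _ fun i hi => by simp [ext, hi]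
  · ext ω
    exact hGT _ _ fun i hi => by simp [ext, hi]

/-- The contribution at `z` of the squares of side `2 ^ k`, as a function of the noise. -/
noncomputable def level (n k : ℕ) (z : ℤ × ℤ) (x : ℕ × box n → ℝ) : ℝ :=
  ∑ c ∈ cornersAt k z, x (k, wrap n c)

/-- The contribution at `z` of the squares of sides `2 ^ k₀, …, 2 ^ l`. -/
noncomputable def partialField (n k₀ l : ℕ) (z : ℤ × ℤ) (x : ℕ × box n → ℝ) : ℝ :=
  ∑ k ∈ Finset.Icc k₀ l, level n k z x

/-- The noise variables on which `level n k z` depends. -/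
noncomputable def reads (n k : ℕ) (z : ℤ × ℤ) : Finset (ℕ × box n) :=
  (cornersAt k z).image fun c => (k, wrap n c)

@[fun_prop]
theorem measurable_level (n k : ℕ) (z : ℤ × ℤ) : Measurable (level n k z) := by
  unfold level; fun_prop

@[fun_prop]
theorem measurable_partialField (n k₀ l : ℕ) (z : ℤ × ℤ) : Measurable (partialField n k₀ l z) := by
  unfold partialField; fun_prop

theorem level_congr {n k : ℕ} {z : ℤ × ℤ} {x y : ℕ × box n → ℝ}
    (h : ∀ i ∈ reads n k z, x i = y i) : level n k z x = level n k z y :=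
  Finset.sum_congr rfl fun _ hc => h _ (Finset.mem_image_of_mem _ hc)

theorem card_cornersAt (k : ℕ) (z : ℤ × ℤ) : (cornersAt k z).card = 2 ^ (2 * k) := by
  have : ∀ a : ℤ, a + 1 - (a - 2 ^ k + 1) = ((2 ^ k : ℕ) : ℤ) := by intro a; push_cast; ring
  simp only [cornersAt, Finset.card_product, Int.card_Icc, this, Int.toNat_natCast]
  ring

theorem dvd_sub_of_wrap_eq {n : ℕ} {c d : ℤ × ℤ} (h : wrap n c = wrap n d) :
    (2 : ℤ) ^ n ∣ c.1 - d.1 ∧ (2 : ℤ) ^ n ∣ c.2 - d.2 := by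
  have h' := congrArg Subtype.val h
  simp only [wrap, Prod.mk.injEq] at h'
  exact ⟨Int.ModEq.dvd h'.1.symm, Int.ModEq.dvd h'.2.symm⟩

theorem eq_of_wrap_eq {n : ℕ} {c d : ℤ × ℤ} (h : wrap n c = wrap n d)
    (h1 : |c.1 - d.1| < 2 ^ n) (h2 : |c.2 - d.2| < 2 ^ n) : c = d := by
  obtain ⟨hd1, hd2⟩ := dvd_sub_of_wrap_eq h
  ext
  · exact sub_eq_zero.1 (Int.eq_zero_of_abs_lt_dvd hd1 h1)
  · exact sub_eq_zero.1 (Int.eq_zero_of_abs_lt_dvd hd2 h2)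

theorem wrap_injOn_cornersAt {n k : ℕ} (hk : k ≤ n) (z : ℤ × ℤ) :
    Set.InjOn (fun c => wrap n c) (cornersAt k z : Set (ℤ × ℤ)) := by
  intro c hc d hd h
  simp only [cornersAt, Finset.coe_product, Finset.coe_Icc, mem_prod, mem_Icc] at hc hd
  have : (2 : ℤ) ^ k ≤ 2 ^ n := pow_le_pow_right₀ (by norm_num) hk
  refine eq_of_wrap_eq h ?_ ?_ <;> rw [abs_lt] <;> constructor <;> linarith

section Noise

variable {Ω : Type*} [MeasurableSpace Ω] {P : Measure Ω} [IsProbabilityMeasure P] {n : ℕ}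
  {b : ℕ → box n → Ω → ℝ}

/-- `4 ^ k` distinct noise variables of variance `4 ^ (-k)` contribute to a level. -/
theorem IsNoise.hasLaw_level (hb : IsNoise n b P) {k : ℕ} (hk : k ≤ n) (z : ℤ × ℤ) :
    HasLaw (fun ω => level n k z fun i => b i.1 i.2 ω) (gaussianReal 0 1) P := by
  have hind : iIndepFun (fun c : box n => b k c) P :=
    hb.indep.precomp (g := fun c => (k, c)) (Prod.mk_right_injective k)
  have := hasLaw_sum_gaussianReal (hb.hasLaw k) hind ((cornersAt k z).image (wrap n))
  rw [Finset.sum_const, Finset.card_image_of_injOn (wrap_injOn_cornersAt hk z),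
    card_cornersAt] at this
  have e : (2 ^ (2 * k) : ℕ) • ((2 : ℝ≥0) ^ (2 * k))⁻¹ = 1 := by
    rw [nsmul_eq_mul]; push_cast; exact mul_inv_cancel₀ (by positivity)
  rw [e] at this
  have e2 : (fun ω => ∑ c ∈ (cornersAt k z).image (wrap n), b k c ω) =
      fun ω => level n k z fun i => b i.1 i.2 ω := by
    ext ω
    rw [Finset.sum_image (wrap_injOn_cornersAt hk z)]; rfl
  rwa [e2] at this

theorem IsNoise.iIndepFun_level (hb : IsNoise n b P) (hm : ∀ k c, Measurable (b k c)) (z : ℤ × ℤ) :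
    iIndepFun (fun k ω => level n k z fun i => b i.1 i.2 ω) P := by
  have hblock : iIndepFun (fun (k : ℕ) ω (c : box n) => b k c ω) P := by
    have hlaw : ∀ k c, IsProbabilityMeasure (P.map (b k c)) := fun k c =>
      Measure.isProbabilityMeasure_map (hm k c).aemeasurable
    have hbm : ∀ k, IsProbabilityMeasure (P.map fun ω (c : box n) => b k c ω) := fun k =>
      Measure.isProbabilityMeasure_map (by fun_prop)
    rw [iIndepFun_iff_map_fun_eq_infinitePi_map (by fun_prop)]
    have h1 := hb.indep.map_fun_eq_infinitePi_map fun i : ℕ × box n => hm i.1 i.2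
    have h2 := congrArg (fun μ => μ.map (MeasurableEquiv.curry ℕ (box n) ℝ)) h1
    rw [Measure.infinitePi_map_curry (fun k c => P.map (b k c)),
      Measure.map_map (by fun_prop) (by fun_prop)] at h2
    refine h2.trans ?_
    congr 1
    ext1 k
    exact ((hb.indep.precomp (g := fun c => (k, c))
      (Prod.mk_right_injective k)).map_fun_eq_infinitePi_map fun c => hm k c).symm
  exact hblock.comp (fun k y => ∑ c ∈ cornersAt k z, y (wrap n c)) fun k => by fun_prop

theorem IsNoise.integrable_level (hb : IsNoise n b P) {k : ℕ} (hk : k ≤ n) (z : ℤ × ℤ) :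
    Integrable (fun ω => level n k z fun i => b i.1 i.2 ω) P := by
  have h := (memLp_id_gaussianReal' (μ := 0) (v := 1) 1 (by simp)).integrable le_rfl
  rw [← (hb.hasLaw_level hk z).map_eq] at h
  exact h.comp_aemeasurable (hb.hasLaw_level hk z).aemeasurable

theorem IsNoise.integral_level (hb : IsNoise n b P) {k : ℕ} (hk : k ≤ n) (z : ℤ × ℤ) :
    ∫ ω, level n k z (fun i => b i.1 i.2 ω) ∂P = 0 := by
  rw [(hb.hasLaw_level hk z).integral_eq, integral_id_gaussianReal]

theorem IsNoise.integrable_partialField (hb : IsNoise n b P) {k₀ l : ℕ} (hl : l ≤ n) (z : ℤ × ℤ) :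
    Integrable (fun ω => partialField n k₀ l z fun i => b i.1 i.2 ω) P :=
  integrable_finsetSum _ fun _ hk => hb.integrable_level ((Finset.mem_Icc.1 hk).2.trans hl) z

theorem IsNoise.integral_partialField (hb : IsNoise n b P) {k₀ l : ℕ} (hl : l ≤ n) (z : ℤ × ℤ) :
    ∫ ω, partialField n k₀ l z (fun i => b i.1 i.2 ω) ∂P = 0 := by
  unfold partialField
  rw [integral_finsetSum _ fun _ hk => hb.integrable_level ((Finset.mem_Icc.1 hk).2.trans hl) z]
  exact Finset.sum_eq_zero fun k hk => hb.integral_level ((Finset.mem_Icc.1 hk).2.trans hl) z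

/-- The contributions at `z` of the scales `k₀ + m, …, k₀`, from the coarsest to the finest. -/
noncomputable def path (n k₀ m : ℕ) (z : ℤ × ℤ) (x : ℕ × box n → ℝ) (j : Fin (m + 1)) : ℝ :=
  level n (k₀ + m - j) z x

theorem sum_path (n k₀ m : ℕ) (z : ℤ × ℤ) (x : ℕ × box n → ℝ) :
    ∑ j, path n k₀ m z x j = partialField n k₀ (k₀ + m) z x := by
  unfold path partialField
  rw [Fin.sum_univ_eq_sum_range (fun j => level n (k₀ + m - j) z x) (m + 1)]
  refine Finset.sum_nbij' (fun j => k₀ + m - j) (fun k => k₀ + m - k) ?_ ?_ ?_ ?_ fun _ _ => rfl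
  all_goals
    intro r hr
    simp only [Finset.mem_range, Finset.mem_Icc] at hr ⊢
    omega

theorem IsNoise.hasLaw_path (hb : IsNoise n b P) (hm : ∀ k c, Measurable (b k c)) {k₀ m : ℕ}
    (hl : k₀ + m ≤ n) (z : ℤ × ℤ) :
    HasLaw (fun ω => path n k₀ m z fun i => b i.1 i.2 ω) (stdNormal (m + 1)) P := by
  have hinj : Function.Injective fun j : Fin (m + 1) => k₀ + m - j.val := by
    intro i j h
    ext
    simp only at h
    omega
  exact ((hb.iIndepFun_level hm z).precomp hinj).hasLaw_pi
    fun j => hb.hasLaw_level (by omega) z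

/-- The squares of side `2 ^ k` containing two points at distance at least `2 ^ k` use disjoint sets
of noise variables, as long as there is no wrapping around the torus. -/
theorem disjoint_reads {k k' : ℕ} {z w : ℤ × ℤ}
    (hsep : (2 : ℤ) ^ k ≤ |z.1 - w.1| ∨ (2 : ℤ) ^ k ≤ |z.2 - w.2|)
    (h1 : |z.1 - w.1| + 2 ^ k ≤ 2 ^ n) (h2 : |z.2 - w.2| + 2 ^ k ≤ 2 ^ n) :
    Disjoint (reads n k' z) (reads n k w) := by
  rw [Finset.disjoint_left]
  intro i hi hi'
  obtain ⟨c, hc, rfl⟩ := Finset.mem_image.1 hi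
  obtain ⟨d, hd, hcd⟩ := Finset.mem_image.1 hi'
  obtain ⟨rfl, hw⟩ := Prod.mk.injEq .. ▸ hcd
  simp only [cornersAt, Finset.mem_product, Finset.mem_Icc] at hc hd
  have hdc : d = c := by
    refine eq_of_wrap_eq hw ?_ ?_
    · rw [abs_lt]; constructor <;> linarith [neg_abs_le (z.1 - w.1), le_abs_self (z.1 - w.1)]
    · rw [abs_lt]; constructor <;> linarith [neg_abs_le (z.2 - w.2), le_abs_self (z.2 - w.2)]
  subst hdc
  rcases hsep with h | h
  · have : |z.1 - w.1| < 2 ^ k := by rw [abs_lt]; constructor <;> linarith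
    linarith
  · have : |z.2 - w.2| < 2 ^ k := by rw [abs_lt]; constructor <;> linarith
    linarith

theorem disjoint_reads_of_ne {k k' : ℕ} (h : k' ≠ k) (z w : ℤ × ℤ) :
    Disjoint (reads n k' z) (reads n k w) := by
  rw [Finset.disjoint_left]
  intro i hi hi'
  obtain ⟨c, hc, rfl⟩ := Finset.mem_image.1 hi
  obtain ⟨d, hd, hcd⟩ := Finset.mem_image.1 hi'
  exact h (congrArg Prod.fst hcd).symm

end Noise

/-! ### Pairs of points and the probability of a high point -/

/-- The number of bits of the sup-distance of two points of `ℕ²`: a square of side `2 ^ k` can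
contain both points only if `k` is at least this number. -/
def separation (z w : ℕ × ℕ) : ℕ := Nat.size (max (Nat.dist z.1 w.1) (Nat.dist z.2 w.2))

/-- At most `4 * 4 ^ r` points lie at sup-distance less than `2 ^ r` from `z`. -/
theorem card_separation_eq_le (S : Finset (ℕ × ℕ)) (z : ℕ × ℕ) (r : ℕ) :
    (S.filter fun w => separation z w = r).card ≤ 4 * 4 ^ r := by
  have hsub : (S.filter fun w => separation z w = r) ⊆
      Finset.Ico (z.1 + 1 - 2 ^ r) (z.1 + 2 ^ r) ×ˢ Finset.Ico (z.2 + 1 - 2 ^ r) (z.2 + 2 ^ r) := by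
    intro w hw
    have h := (Finset.mem_filter.1 hw).2
    have h1 : max (Nat.dist z.1 w.1) (Nat.dist z.2 w.2) < 2 ^ r := by
      rw [← h]; exact Nat.lt_size_self _
    have h2 := (le_max_left _ _).trans_lt h1
    have h3 := (le_max_right _ _).trans_lt h1
    simp only [Nat.dist] at h2 h3
    simp only [Finset.mem_product, Finset.mem_Ico]
    omega
  refine (Finset.card_le_card hsub).trans ?_
  rw [Finset.card_product, Nat.card_Ico, Nat.card_Ico]
  have h1 : ∀ a : ℕ, a + 2 ^ r - (a + 1 - 2 ^ r) ≤ 2 * 2 ^ r := fun a => by omega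
  calc _ ≤ 2 * 2 ^ r * (2 * 2 ^ r) := Nat.mul_le_mul (h1 _) (h1 _)
    _ = 4 * 4 ^ r := by
      rw [show 4 = 2 * 2 by rfl, mul_pow]; ring

/-- The points of a translate of the lattice `2 ^ k₀ ℤ²`. -/
def site (k₀ : ℕ) (z₀ : ℤ × ℤ) (u : ℕ × ℕ) : ℤ × ℤ :=
  (z₀.1 + 2 ^ k₀ * u.1, z₀.2 + 2 ^ k₀ * u.2)

/-- Two sites share no squares at scales below the one given by their separation. The hypothesis on
`n` leaves enough room on the torus: the sites lie in a square of at most half its side. -/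
theorem disjoint_reads_site {n k₀ m : ℕ} (hn : k₀ + m + 1 ≤ n) (z₀ : ℤ × ℤ) {u v : ℕ × ℕ}
    (hu : u.1 < 2 ^ m ∧ u.2 < 2 ^ m) (hv : v.1 < 2 ^ m ∧ v.2 < 2 ^ m) {k k' : ℕ}
    (hk₀ : k₀ ≤ k) (hk : k < k₀ + separation u v) :
    Disjoint (reads n k' (site k₀ z₀ u)) (reads n k (site k₀ z₀ v)) := by
  have hd : ∀ (x : ℤ) (a c : ℕ), |(x + 2 ^ k₀ * (a : ℤ)) - (x + 2 ^ k₀ * c)| =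
      2 ^ k₀ * (Nat.dist a c : ℤ) := by
    intro x a c
    rw [add_sub_add_left_eq_sub, ← mul_sub, abs_mul, abs_of_pos (by positivity)]
    congr 1
    simp only [Nat.dist]
    rcases abs_cases ((a : ℤ) - c) with ⟨h, _⟩ | ⟨h, _⟩ <;> rw [h] <;> omega
  have hdm : ∀ a b : ℕ, a < 2 ^ m → b < 2 ^ m → Nat.dist a b < 2 ^ m := by
    intro a b ha hb
    simp only [Nat.dist]; omega
  set d := max (Nat.dist u.1 v.1) (Nat.dist u.2 v.2) with hdef
  have hdlt : d < 2 ^ m := max_lt (hdm _ _ hu.1 hv.1) (hdm _ _ hu.2 hv.2)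
  have hsep : separation u v ≤ m := Nat.size_le.2 hdlt
  have hkl : (2 : ℤ) ^ k ≤ 2 ^ (k₀ + m) := pow_le_pow_right₀ (by norm_num) (by omega)
  have hln : (2 : ℤ) ^ (k₀ + m) + 2 ^ (k₀ + m) ≤ 2 ^ n := by
    calc (2 : ℤ) ^ (k₀ + m) + 2 ^ (k₀ + m) = 2 ^ (k₀ + m + 1) := by ring
      _ ≤ _ := pow_le_pow_right₀ (by norm_num) hn
  have hw : ∀ a b : ℕ, a < 2 ^ m → b < 2 ^ m →
      (2 : ℤ) ^ k₀ * (Nat.dist a b : ℤ) + 2 ^ k ≤ 2 ^ n := by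
    intro a b ha hb
    have h1 : (Nat.dist a b : ℤ) ≤ 2 ^ m := by exact_mod_cast (hdm a b ha hb).le
    have h2 : (2 : ℤ) ^ k₀ * (Nat.dist a b : ℤ) ≤ 2 ^ (k₀ + m) := by
      rw [pow_add]; exact mul_le_mul_of_nonneg_left h1 (by positivity)
    linarith
  have hjd : 2 ^ (k - k₀) ≤ d := Nat.lt_size.1 (show k - k₀ < separation u v by omega)
  have hkd : (2 : ℤ) ^ k ≤ 2 ^ k₀ * d := by
    calc (2 : ℤ) ^ k = 2 ^ k₀ * 2 ^ (k - k₀) := by rw [← pow_add, Nat.add_sub_cancel' hk₀]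
      _ ≤ _ := mul_le_mul_of_nonneg_left (by exact_mod_cast hjd) (by positivity)
  refine disjoint_reads ?_ ?_ ?_
  · simp only [site, hd]
    rcases max_choice (Nat.dist u.1 v.1) (Nat.dist u.2 v.2) with h | h
    · left; rw [hdef, h] at hkd; exact hkd
    · right; rw [hdef, h] at hkd; exact hkd
  · simp only [site, hd]; exact hw _ _ hu.1 hv.1
  · simp only [site, hd]; exact hw _ _ hu.2 hv.2

theorem measurable_path (n k₀ m : ℕ) (z : ℤ × ℤ) : Measurable (path n k₀ m z) := by
  unfold path; fun_prop

/-- The last `separation u v` steps of the path of one site are independent of its earlier steps and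
of the whole path of the other site. -/
theorem IsNoise.indepFun_path {Ω : Type*} [MeasurableSpace Ω] {P : Measure Ω}
    [IsProbabilityMeasure P] {n : ℕ} {b : ℕ → box n → Ω → ℝ} (hb : IsNoise n b P)
    (hm : ∀ k c, Measurable (b k c)) {k₀ m : ℕ} (hn : k₀ + m + 1 ≤ n) (z₀ : ℤ × ℤ) {u v : ℕ × ℕ}
    (hu : u.1 < 2 ^ m ∧ u.2 < 2 ^ m) (hv : v.1 < 2 ^ m ∧ v.2 < 2 ^ m) {t r : ℕ} (h : t + r = m + 1)
    (hr : r = separation u v) :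
    IndepFun (fun ω => (path n k₀ m (site k₀ z₀ u) (fun i => b i.1 i.2 ω),
        fun i : Fin t => path n k₀ m (site k₀ z₀ v) (fun i => b i.1 i.2 ω) ⟨i, by omega⟩))
      (fun ω (i : Fin r) => path n k₀ m (site k₀ z₀ v) (fun i => b i.1 i.2 ω) ⟨t + i, by omega⟩)
      P := by
  let S : Finset (ℕ × box n) :=
    ((Finset.range (m + 1)).biUnion fun j => reads n (k₀ + m - j) (site k₀ z₀ u)) ∪
      (Finset.range t).biUnion fun j => reads n (k₀ + m - j) (site k₀ z₀ v)
  let T : Finset (ℕ × box n) :=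
    (Finset.range r).biUnion fun j => reads n (k₀ + m - (t + j)) (site k₀ z₀ v)
  have hST : Disjoint S T := by
    rw [Finset.disjoint_union_left]
    simp only [T, Finset.disjoint_biUnion_left, Finset.disjoint_biUnion_right, Finset.mem_range]
    constructor
    · intro j _ i hi
      exact disjoint_reads_site hn z₀ hu hv (by omega) (by omega)
    · intro j hj i hi
      exact disjoint_reads_of_ne (by omega) _ _
  refine indepFun_of_disjoint_blocks (X := fun i : ℕ × box n => b i.1 i.2) (fun i => hm i.1 i.2)
    hb.indep hST
    (F := fun x => (path n k₀ m (site k₀ z₀ u) x, fun i : Fin t =>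
      path n k₀ m (site k₀ z₀ v) x ⟨i, by omega⟩))
    (G := fun x (i : Fin r) => path n k₀ m (site k₀ z₀ v) x ⟨t + i, by omega⟩) ?_ ?_ ?_ ?_
  · unfold path; fun_prop
  · unfold path; fun_prop
  · intro x y hxy
    refine Prod.ext (funext fun j => level_congr fun i hi => hxy i ?_)
      (funext fun j => level_congr fun i hi => hxy i ?_)
    · exact Finset.mem_union_left _ (Finset.mem_biUnion.2 ⟨j, Finset.mem_range.2 j.2, hi⟩)
    · exact Finset.mem_union_right _ (Finset.mem_biUnion.2 ⟨j, Finset.mem_range.2 j.2, hi⟩)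
  · intro x y hxy
    exact funext fun j => level_congr fun i hi =>
      hxy i (Finset.mem_biUnion.2 ⟨j, Finset.mem_range.2 j.2, hi⟩)

/-- In every square of side `2 ^ (k₀ + m)`, the field made of the scales `k₀, …, k₀ + m` reaches the
centring of `m + 1` scales with probability bounded below. -/
theorem exists_measureReal_square_ge :
    ∃ p : ℝ, 0 < p ∧ ∀ (n k₀ m : ℕ), k₀ + m + 1 ≤ n → ∀ (Ω : Type*) [MeasurableSpace Ω]
      (P : Measure Ω) [IsProbabilityMeasure P] (b : ℕ → box n → Ω → ℝ), IsNoise n b P →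
      (∀ k c, Measurable (b k c)) → ∀ z₀ : ℤ × ℤ,
      p ≤ P.real {ω | ∃ z ∈ square (k₀ + m) z₀, ((m + 1 : ℕ) : ℝ) * slope (m + 1) ≤
        partialField n k₀ (k₀ + m) z fun i => b i.1 i.2 ω} := by
  obtain ⟨p, hp, h⟩ := exists_measureReal_exists_le_sum_ge
  refine ⟨p, hp, fun n k₀ m hn Ω _ P _ b hb hm z₀ => ?_⟩
  let S : Finset (ℕ × ℕ) := Finset.range (2 ^ m) ×ˢ Finset.range (2 ^ m)
  have hS : ∀ u ∈ S, u.1 < 2 ^ m ∧ u.2 < 2 ^ m := fun u hu => by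
    simpa only [S, Finset.mem_product, Finset.mem_range] using hu
  refine (h (m + 1) (by omega) Ω P (ℕ × ℕ) S
    (fun u ω => path n k₀ m (site k₀ z₀ u) fun i => b i.1 i.2 ω) separation
    (fun u _ => (measurable_path _ _ _ _).comp (by fun_prop))
    (fun u _ => hb.hasLaw_path hm (by omega) _) ?_ ?_ ?_
    (fun u _ r => card_separation_eq_le S u r)).trans ?_
  · rw [Finset.card_product, Finset.card_range, Nat.add_sub_cancel, ← mul_pow]
    norm_num
  · intro u hu v hv
    have hu := hS u hu
    have hv := hS v hv
    refine Nat.lt_succ_of_le (Nat.size_le.2 (max_lt ?_ ?_)) <;> simp only [Nat.dist] <;> omega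
  · intro u hu v hv t r htr hr
    exact hb.indepFun_path hm hn z₀ (hS u hu) (hS v hv) htr hr
  · refine measureReal_mono ?_ (measure_ne_top _ _)
    rintro ω ⟨u, hu, hω⟩
    obtain ⟨hu1, hu2⟩ := hS u hu
    refine ⟨site k₀ z₀ u, ?_, by rwa [sum_path] at hω⟩
    have hb1 : ∀ a : ℕ, a < 2 ^ m → (0 : ℤ) ≤ 2 ^ k₀ * a ∧ (2 : ℤ) ^ k₀ * a ≤ 2 ^ (k₀ + m) - 1 := by
      intro a ha
      have h1 : (a : ℤ) ≤ 2 ^ m - 1 := by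
        have : (a : ℤ) < 2 ^ m := by exact_mod_cast ha
        linarith
      have h2 : (1 : ℤ) ≤ 2 ^ k₀ := one_le_pow₀ (by norm_num)
      refine ⟨by positivity, ?_⟩
      rw [pow_add]
      nlinarith
    have := hb1 u.1 hu1
    have := hb1 u.2 hu2
    simp only [square, site, Finset.mem_product, Finset.mem_Icc]
    refine ⟨⟨?_, ?_⟩, ?_, ?_⟩ <;> linarith

/-! ### The recursion for the expected maximum -/

theorem integrable_finset_sup' {Ω ι : Type*} [MeasurableSpace Ω] {P : Measure Ω} {S : Finset ι}
    (hS : S.Nonempty) {f : ι → Ω → ℝ} (hf : ∀ z ∈ S, Integrable (f z) P) :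
    Integrable (fun ω => S.sup' hS fun z => f z ω) P := by
  have h := Finset.sup'_induction hS f (p := fun g => Integrable g P)
    (fun _ h₁ _ h₂ => h₁.sup h₂) hf
  convert h using 1
  ext ω
  rw [Finset.sup'_apply]

/-- Adding an independent centred field does not decrease the expected maximum. -/
theorem integral_sup'_le_integral_sup'_add {Ω ι : Type*} [MeasurableSpace Ω] {P : Measure Ω}
    [IsProbabilityMeasure P] {S : Finset ι} (hS : S.Nonempty) {A B : Ω → ι → ℝ}
    (hA : Measurable A) (hind : IndepFun A B P)
    (hAi : ∀ z ∈ S, Integrable (fun ω => A ω z) P) (hBi : ∀ z ∈ S, Integrable (fun ω => B ω z) P)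
    (hB0 : ∀ z ∈ S, ∫ ω, B ω z ∂P = 0) :
    ∫ ω, S.sup' hS (fun z => A ω z) ∂P ≤ ∫ ω, S.sup' hS (fun z => A ω z + B ω z) ∂P := by
  classical
  -- `w z a` are weights that distribute a unit mass over the points where `a` is maximal on `S`.
  let e : ι → (ι → ℝ) → ℝ := fun z a => if a z = S.sup' hS a then 1 else 0
  let c : (ι → ℝ) → ℝ := fun a => ∑ z ∈ S, e z a
  let w : ι → (ι → ℝ) → ℝ := fun z a => e z a / c a
  have he0 : ∀ z a, 0 ≤ e z a := fun z a => by simp only [e]; split_ifs <;> norm_num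
  have hsup : Measurable fun a : ι → ℝ => S.sup' hS a := by
    have := Finset.measurable_sup' hS (f := fun z (a : ι → ℝ) => a z)
      fun z _ => measurable_pi_apply z
    convert this using 1
    ext a; rw [Finset.sup'_apply]
  have hem : ∀ z, Measurable (e z) := fun z =>
    Measurable.ite (measurableSet_eq_fun (measurable_pi_apply z) hsup) measurable_const
      measurable_const
  have hwm : ∀ z, Measurable (w z) := fun z =>
    (hem z).div (Finset.measurable_fun_sum S fun z _ => hem z)
  have hc : ∀ a, 1 ≤ c a := by
    intro a
    obtain ⟨z, hz, h⟩ := Finset.exists_mem_eq_sup' hS a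
    have h1 : e z a = 1 := by simp only [e]; rw [if_pos h.symm]
    rw [← h1]
    exact Finset.single_le_sum (fun z _ => he0 z a) hz
  have hw0 : ∀ z a, 0 ≤ w z a := fun z a => div_nonneg (he0 z a) (by linarith [hc a])
  have hw1 : ∀ a, ∑ z ∈ S, w z a = 1 := fun a => by
    simp only [w]
    rw [← Finset.sum_div]
    exact div_self (by linarith [hc a])
  have hwle : ∀ z a, w z a ≤ 1 := fun z a => by
    refine (div_le_one (by linarith [hc a])).2 (le_trans ?_ (hc a))
    simp only [e]; split_ifs <;> norm_num
  have hwa : ∀ a, ∑ z ∈ S, w z a * a z = S.sup' hS a := by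
    intro a
    have : ∀ z ∈ S, w z a * a z = w z a * S.sup' hS a := by
      intro z _
      by_cases h : a z = S.sup' hS a
      · rw [h]
      · have : w z a = 0 := by simp only [w, e]; rw [if_neg h, zero_div]
        rw [this, zero_mul, zero_mul]
    rw [Finset.sum_congr rfl this, ← Finset.sum_mul, hw1, one_mul]
  have hiw : ∀ z, IndepFun (fun ω => w z (A ω)) (fun ω => B ω z) P := fun z =>
    hind.comp (hwm z) (measurable_pi_apply z)
  have hwint : ∀ z, Integrable (fun ω => w z (A ω)) P := fun z =>
    Integrable.of_bound ((hwm z).comp hA).aestronglyMeasurable 1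
      (Filter.Eventually.of_forall fun ω => by
        rw [Real.norm_of_nonneg (hw0 _ _)]; exact hwle _ _)
  have hprod : ∀ z ∈ S, Integrable (fun ω => w z (A ω) * B ω z) P := fun z hz =>
    (hiw z).integrable_mul (hwint z) (hBi z hz)
  have hprod0 : ∀ z ∈ S, ∫ ω, w z (A ω) * B ω z ∂P = 0 := by
    intro z hz
    rw [(hiw z).integral_fun_mul_eq_mul_integral (hwint z).aestronglyMeasurable
      (hBi z hz).aestronglyMeasurable, hB0 z hz, mul_zero]
  have hpt : ∀ ω, S.sup' hS (fun z => A ω z) + ∑ z ∈ S, w z (A ω) * B ω z ≤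
      S.sup' hS (fun z => A ω z + B ω z) := by
    intro ω
    rw [← hwa (A ω), ← Finset.sum_add_distrib]
    calc _ ≤ ∑ z ∈ S, w z (A ω) * S.sup' hS (fun z => A ω z + B ω z) := by
          refine Finset.sum_le_sum fun z hz => ?_
          rw [← mul_add]
          exact mul_le_mul_of_nonneg_left
            (Finset.le_sup' (fun z => A ω z + B ω z) hz) (hw0 _ _)
      _ = _ := by rw [← Finset.sum_mul, hw1, one_mul]
  have hAint := integrable_finset_sup' (P := P) hS (f := fun z ω => A ω z) hAi
  have h := integral_mono (hAint.add (integrable_finsetSum S hprod))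
    (integrable_finset_sup' (P := P) hS (f := fun z ω => A ω z + B ω z)
      fun z hz => (hAi z hz).add (hBi z hz)) hpt
  simp only [Pi.add_apply] at h
  rw [integral_add hAint (integrable_finsetSum S hprod), integral_finsetSum S hprod,
    Finset.sum_eq_zero hprod0, add_zero] at h
  exact h

/-- The maximum over `[0, 2 ^ l)²` of the field made of the scales `k₀, …, l`. -/
noncomputable def subMax (n k₀ l : ℕ) (x : ℕ × box n → ℝ) : ℝ :=
  (box l).sup' (box_nonempty l) fun z => partialField n k₀ l z x

theorem measurable_subMax (n k₀ l : ℕ) : Measurable (subMax n k₀ l) := by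
  have := Finset.measurable_sup' (box_nonempty l) (f := fun z => partialField n k₀ l z)
    fun z _ => measurable_partialField n k₀ l z
  convert this using 1
  ext x; rw [Finset.sup'_apply]; rfl

theorem box_mono {l l' : ℕ} (h : l ≤ l') : box l ⊆ box l' := by
  have : (2 : ℤ) ^ l ≤ 2 ^ l' := pow_le_pow_right₀ (by norm_num) h
  intro z hz
  simp only [box, Finset.mem_product, Finset.mem_Icc] at hz ⊢
  omega

theorem square_subset_box (l : ℕ) : square l (2 ^ (l + 1), 0) ⊆ box (l + 2) := by
  have h0 : (0 : ℤ) < 2 ^ l := by positivity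
  intro z hz
  simp only [square, box, Finset.mem_product, Finset.mem_Icc, pow_succ] at hz ⊢
  omega

/-- Two squares of side `2 ^ l` at distance `2 ^ l` use disjoint sets of noise variables up to
scale `l`. -/
theorem disjoint_reads_of_mem {n l k k' : ℕ} (hn : l + 2 ≤ n) (hk : k ≤ l) {z w : ℤ × ℤ}
    (hz : z ∈ box l) (hw : w ∈ square l (2 ^ (l + 1), 0)) :
    Disjoint (reads n k' z) (reads n k w) := by
  have hkl : (2 : ℤ) ^ k ≤ 2 ^ l := pow_le_pow_right₀ (by norm_num) hk
  have hln : (2 : ℤ) ^ (l + 2) ≤ 2 ^ n := pow_le_pow_right₀ (by norm_num) hn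
  simp only [square, box, Finset.mem_product, Finset.mem_Icc, pow_succ] at hz hw hln
  refine disjoint_reads (Or.inl ?_) ?_ ?_
  · rw [abs_sub_comm]; refine le_trans ?_ (le_abs_self _); omega
  · have : |z.1 - w.1| ≤ 3 * 2 ^ l := by rw [abs_le]; constructor <;> omega
    omega
  · have : |z.2 - w.2| ≤ 2 ^ l := by rw [abs_le]; constructor <;> omega
    omega

theorem partialField_congr {n k₀ l : ℕ} {z : ℤ × ℤ} {x y : ℕ × box n → ℝ}
    (h : ∀ k ∈ Finset.Icc k₀ l, ∀ i ∈ reads n k z, x i = y i) :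
    partialField n k₀ l z x = partialField n k₀ l z y :=
  Finset.sum_congr rfl fun k hk => level_congr (h k hk)

section Noise

variable {Ω : Type*} [MeasurableSpace Ω] {P : Measure Ω} [IsProbabilityMeasure P] {n : ℕ}
  {b : ℕ → box n → Ω → ℝ}

theorem IsNoise.integrable_subMax (hb : IsNoise n b P) {k₀ l : ℕ} (hl : l ≤ n) :
    Integrable (fun ω => subMax n k₀ l fun i => b i.1 i.2 ω) P :=
  integrable_finset_sup' (box_nonempty l)
    (f := fun z ω => partialField n k₀ l z fun i => b i.1 i.2 ω)
    fun z _ => hb.integrable_partialField hl z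

/-- The maximum is at least the value at one point, which is centred. -/
theorem IsNoise.integral_subMax_nonneg (hb : IsNoise n b P) {k₀ l : ℕ} (hl : l ≤ n) :
    0 ≤ ∫ ω, subMax n k₀ l (fun i => b i.1 i.2 ω) ∂P := by
  obtain ⟨z, hz⟩ := box_nonempty l
  rw [← hb.integral_partialField (k₀ := k₀) hl z]
  exact integral_mono (hb.integrable_partialField hl z) (hb.integrable_subMax hl) fun ω =>
    Finset.le_sup' (fun z => partialField n k₀ l z fun i => b i.1 i.2 ω) hz

/-- Recursion for the expected maximum: the two coarsest scales are averaged out, and one square at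
the origin is compared with a second, independent one. -/
theorem IsNoise.integral_subMax_add_two_ge (hb : IsNoise n b P) (hm : ∀ k c, Measurable (b k c))
    {k₀ l : ℕ} (hl : k₀ ≤ l) (hn : l + 2 ≤ n) (M : ℝ) :
    let y := ∫ ω, subMax n k₀ l (fun i => b i.1 i.2 ω) ∂P
    let q := P.real {ω | ∃ z ∈ square l (2 ^ (l + 1), 0),
      M ≤ partialField n k₀ l z fun i => b i.1 i.2 ω}
    y + q * (M - y) ≤ ∫ ω, subMax n k₀ (l + 2) (fun i => b i.1 i.2 ω) ∂P := by
  intro y q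
  have hnoise : Measurable fun ω (i : ℕ × box n) => b i.1 i.2 ω := by fun_prop
  have hbm : ∀ i : ℕ × box n, Measurable (b i.1 i.2) := fun i => hm i.1 i.2
  let Q : Set (ℕ × box n → ℝ) :=
    {x | ∃ z ∈ square l (2 ^ (l + 1), 0), M ≤ partialField n k₀ l z x}
  have hQ : MeasurableSet Q := by
    have : Q = ⋃ z ∈ square l (2 ^ (l + 1), 0), {x | M ≤ partialField n k₀ l z x} := by
      ext x; simp [Q]
    rw [this]
    exact Finset.measurableSet_biUnion _ fun z _ =>
      measurableSet_le measurable_const (measurable_partialField n k₀ l z)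
  let ind : (ℕ × box n → ℝ) → ℝ := Q.indicator 1
  have h1Q : Measurable ind := measurable_one.indicator hQ
  have hQint : ∫ ω, ind (fun i => b i.1 i.2 ω) ∂P = q :=
    integral_indicator_one (hnoise hQ)
  have hQi : Integrable (fun ω => ind (fun i => b i.1 i.2 ω)) P :=
    (integrable_const (1 : ℝ)).indicator (hnoise hQ)
  have hYi := hb.integrable_subMax (k₀ := k₀) (show l ≤ n by omega)
  -- the maximum over the square at the origin is independent of the event for the second square
  have hindQ : IndepFun (fun ω => ind fun i => b i.1 i.2 ω)
      (fun ω => subMax n k₀ l fun i => b i.1 i.2 ω) P := by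
    refine IndepFun.symm (indepFun_of_disjoint_blocks (X := fun i : ℕ × box n => b i.1 i.2) hbm
      hb.indep
      (S := (Finset.Icc k₀ l).biUnion fun k => (box l).biUnion fun z => reads n k z)
      (T := (Finset.Icc k₀ l).biUnion fun k =>
        (square l (2 ^ (l + 1), 0)).biUnion fun z => reads n k z)
      ?_ (measurable_subMax n k₀ l) h1Q ?_ ?_)
    · simp only [Finset.disjoint_biUnion_left, Finset.disjoint_biUnion_right, Finset.mem_Icc]
      intro k hk k' hk' z hz w hw
      exact disjoint_reads_of_mem hn (by omega) (by assumption) (by assumption)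
    · intro x x' hxx
      refine Finset.sup'_congr _ rfl fun z hz => partialField_congr fun k hk i hi => hxx i ?_
      exact Finset.mem_biUnion.2 ⟨k, hk, Finset.mem_biUnion.2 ⟨z, hz, hi⟩⟩
    · intro x x' hxx
      have : x ∈ Q ↔ x' ∈ Q := by
        refine exists_congr fun z => and_congr_right fun hz => ?_
        rw [partialField_congr fun k hk i hi => hxx i (Finset.mem_biUnion.2
          ⟨k, hk, Finset.mem_biUnion.2 ⟨z, hz, hi⟩⟩)]
      by_cases hx : x ∈ Q
      · exact (indicator_of_mem hx 1).trans (indicator_of_mem (this.1 hx) 1).symm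
      · exact (indicator_of_notMem hx 1).trans (indicator_of_notMem (mt this.2 hx) 1).symm
  -- the two coarsest scales are independent of the others
  have hindAB : IndepFun (fun ω z => partialField n k₀ l z fun i => b i.1 i.2 ω)
      (fun ω z => partialField n (l + 1) (l + 2) z fun i => b i.1 i.2 ω) P := by
    refine indepFun_of_disjoint_blocks (X := fun i : ℕ × box n => b i.1 i.2) hbm hb.indep
      (S := Finset.Icc k₀ l ×ˢ Finset.univ) (T := Finset.Icc (l + 1) (l + 2) ×ˢ Finset.univ)
      (F := fun x z => partialField n k₀ l z x)
      (G := fun x z => partialField n (l + 1) (l + 2) z x) ?_ (by fun_prop) (by fun_prop) ?_ ?_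
    · rw [Finset.disjoint_product]
      left
      rw [Finset.disjoint_left]
      intro k h1 h2
      rw [Finset.mem_Icc] at h1 h2
      omega
    all_goals
      intro x x' hxx
      refine funext fun z => partialField_congr fun k hk i hi => hxx i ?_
      obtain ⟨c, -, rfl⟩ := Finset.mem_image.1 hi
      exact Finset.mem_product.2 ⟨hk, Finset.mem_univ _⟩
  have hsplit : ∀ z x, partialField n k₀ (l + 2) z x =
      partialField n k₀ l z x + partialField n (l + 1) (l + 2) z x := by
    intro z x
    unfold partialField
    rw [Finset.sum_Icc_succ_top (by omega), Finset.sum_Icc_succ_top (by omega),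
      Finset.sum_Icc_succ_top (show l + 1 ≤ l + 1 + 1 by omega), Finset.Icc_self,
      Finset.sum_singleton, add_assoc]
  have hJ := integral_sup'_le_integral_sup'_add (P := P) (box_nonempty (l + 2)) (by fun_prop)
    hindAB (fun z _ => hb.integrable_partialField (by omega) z)
    (fun z _ => hb.integrable_partialField hn z) (fun z _ => hb.integral_partialField hn z)
  simp only [← hsplit] at hJ
  refine le_trans ?_ hJ
  have hprod : Integrable (fun ω => ind (fun i => b i.1 i.2 ω) *
      subMax n k₀ l fun i => b i.1 i.2 ω) P := hindQ.integrable_mul hQi hYi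
  have hdiff : Integrable (fun ω => ind (fun i => b i.1 i.2 ω) * M -
      ind (fun i => b i.1 i.2 ω) * subMax n k₀ l fun i => b i.1 i.2 ω) P :=
    (hQi.mul_const M).sub hprod
  have hval : y + q * (M - y) = ∫ ω, (subMax n k₀ l (fun i => b i.1 i.2 ω) +
      (ind (fun i => b i.1 i.2 ω) * M - ind (fun i => b i.1 i.2 ω) *
        subMax n k₀ l fun i => b i.1 i.2 ω)) ∂P := by
    rw [integral_add hYi hdiff, integral_sub (hQi.mul_const M) hprod,
      integral_mul_const, hindQ.integral_fun_mul_eq_mul_integral hQi.aestronglyMeasurable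
      hYi.aestronglyMeasurable, hQint]
    ring
  rw [hval]
  refine integral_mono (hYi.add hdiff)
    (integrable_finset_sup' _ fun z _ => hb.integrable_partialField (by omega) z) fun ω => ?_
  set x : ℕ × box n → ℝ := fun i => b i.1 i.2 ω
  by_cases hx : x ∈ Q
  · have h1 : ind x = 1 := indicator_of_mem hx _
    obtain ⟨z, hz, hzM⟩ := hx
    simp only [h1]
    have h2 := Finset.le_sup' (fun z => partialField n k₀ l z x) (square_subset_box l hz)
    linarith
  · have h1 : ind x = 0 := indicator_of_notMem hx _
    simp only [h1, zero_mul, sub_zero, add_zero]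
    exact Finset.sup'_mono _ (box_mono (by omega)) (box_nonempty l)

end Noise

/-! ### The bound on the gap -/

/-- Two more scales raise the centring by at most `4 √(log 2) ≤ 4`. -/
theorem slope_mul_add_two_le (m : ℕ) :
    ((m + 2 + 1 : ℕ) : ℝ) * slope (m + 2 + 1) ≤ ((m + 1 : ℕ) : ℝ) * slope (m + 1) + 4 := by
  have e : ∀ L : ℕ, 1 ≤ L → (L : ℝ) * slope L =
      2 * √(Real.log 2) * L - 3 / (4 * √(Real.log 2)) * Real.log L := by
    intro L hL
    have : (L : ℝ) ≠ 0 := by exact_mod_cast (by omega : L ≠ 0)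
    unfold slope
    field_simp
  rw [e _ (by omega), e _ (by omega)]
  obtain ⟨h1, h2⟩ := sqrt_log_two_bounds
  have h3 : Real.log (m + 1 : ℕ) ≤ Real.log (m + 2 + 1 : ℕ) :=
    Real.log_le_log (by positivity) (by push_cast; linarith)
  have h4 : 0 ≤ 3 / (4 * √(Real.log 2)) := by positivity
  have h5 := mul_le_mul_of_nonneg_left h3 h4
  push_cast at h5 ⊢
  linarith

/-- The lower bound for a noise made of measurable functions. The constant `K` bounds the gap
between the centring and the expected maximum: two more scales raise the centring by at most `4`,
while the recursion shrinks the gap by the factor `1 - p`. -/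
theorem exists_slope_sub_le_integral_subMax :
    ∃ K : ℝ, 0 ≤ K ∧ ∀ (n k₀ : ℕ) (Ω : Type*) [MeasurableSpace Ω] (P : Measure Ω)
      [IsProbabilityMeasure P] (b : ℕ → box n → Ω → ℝ), IsNoise n b P →
      (∀ k c, Measurable (b k c)) → ∀ m : ℕ, k₀ + m ≤ n →
      ((m + 1 : ℕ) : ℝ) * slope (m + 1) - K ≤
        ∫ ω, subMax n k₀ (k₀ + m) (fun i => b i.1 i.2 ω) ∂P := by
  obtain ⟨p₀, hp₀, h⟩ := exists_measureReal_square_ge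
  obtain ⟨p, hp, hp1, hpp₀⟩ : ∃ p : ℝ, 0 < p ∧ p ≤ 1 ∧ p ≤ p₀ :=
    ⟨min p₀ 1, lt_min hp₀ one_pos, min_le_right _ _, min_le_left _ _⟩
  have hK4 : 4 ≤ 4 / p := by rw [le_div_iff₀ hp]; linarith
  refine ⟨4 / p, by positivity, fun n k₀ Ω _ P _ b hb hm m => ?_⟩
  induction m using Nat.twoStepInduction with
  | zero =>
    intro hn
    have h1 := hb.integral_subMax_nonneg (k₀ := k₀) hn
    have h2 := (slope_bounds (L := 0 + 1) le_rfl).2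
    push_cast at h2 ⊢
    linarith
  | one =>
    intro hn
    have h1 := hb.integral_subMax_nonneg (k₀ := k₀) hn
    have h2 := (slope_bounds (L := 1 + 1) (by norm_num)).2
    push_cast at h2 ⊢
    linarith
  | more m ih _ =>
    intro hn
    have h1 := ih (by omega)
    have h2 := slope_mul_add_two_le m
    have h3 := hb.integral_subMax_add_two_ge hm (k₀ := k₀) (l := k₀ + m) (by omega) (by omega)
      (((m + 1 : ℕ) : ℝ) * slope (m + 1))
    simp only at h3
    have h4 := h n k₀ m (by omega) Ω P b hb hm (2 ^ (k₀ + m + 1), 0)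
    rw [← add_assoc]
    refine le_trans ?_ h3
    set y := ∫ ω, subMax n k₀ (k₀ + m) (fun i => b i.1 i.2 ω) ∂P
    set q := P.real {ω | ∃ z ∈ square (k₀ + m) (2 ^ (k₀ + m + 1), 0),
      ((m + 1 : ℕ) : ℝ) * slope (m + 1) ≤ partialField n k₀ (k₀ + m) z fun i => b i.1 i.2 ω}
    set M := ((m + 1 : ℕ) : ℝ) * slope (m + 1)
    have hq1 : q ≤ 1 := measureReal_le_one
    have h5 : (1 - q) * (M - y) ≤ (1 - q) * (4 / p) :=
      mul_le_mul_of_nonneg_left (by linarith) (by linarith)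
    have h6 : 4 ≤ q * (4 / p) := by
      rw [mul_div_assoc', le_div_iff₀ hp]; linarith
    linarith

end MBRW

theorem mainTheorem5 :
    ∃ f : ℕ → ℝ≥0, ∀ (n k₀ : ℕ), 1 ≤ n → (2 : ℕ) ^ (2 * k₀) ≤ 2 ^ n →
      ∀ (Ω : Type*) [MeasurableSpace Ω] (P : Measure Ω) [IsProbabilityMeasure P]
        (b : ℕ → MBRW.box n → Ω → ℝ), MBRW.IsNoise n b P →
        Integrable (MBRW.maxField n k₀ b) P ∧
        2 * √(Real.log 2) * (n : ℝ) - 3 / (4 * √(Real.log 2)) * Real.log (n : ℝ) - (f k₀ : ℝ)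
          ≤ ∫ ω, MBRW.maxField n k₀ b ω ∂P := by
  obtain ⟨K, hK, h⟩ := MBRW.exists_slope_sub_le_integral_subMax
  refine ⟨fun k₀ => (2 * k₀ + 1 + K).toNNReal, fun n k₀ hn hk Ω _ P _ b hb => ?_⟩
  have hkn : k₀ ≤ n := by
    have := (Nat.pow_le_pow_iff_right (by norm_num)).1 hk
    omega
  refine ⟨hb.integrable_subMax le_rfl, ?_⟩
  rw [Real.coe_toNNReal _ (by positivity)]
  -- the noise variables are only almost everywhere measurable
  let b' : ℕ → MBRW.box n → Ω → ℝ := fun k c => (hb.hasLaw k c).aemeasurable.mk (b k c)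
  have hbb' : ∀ k c, b k c =ᵐ[P] b' k c := fun k c => (hb.hasLaw k c).aemeasurable.ae_eq_mk
  have hb' : MBRW.IsNoise n b' P :=
    ⟨fun k c => (hb.hasLaw k c).congr (hbb' k c).symm, hb.indep.congr fun i => hbb' i.1 i.2⟩
  have heq : ∫ ω, MBRW.maxField n k₀ b ω ∂P =
      ∫ ω, MBRW.subMax n k₀ n (fun i => b' i.1 i.2 ω) ∂P := by
    refine integral_congr_ae ?_
    filter_upwards [ae_all_iff.2 fun k => ae_all_iff.2 fun c => hbb' k c] with ω hω
    have : (fun i : ℕ × MBRW.box n => b' i.1 i.2 ω) = fun i => b i.1 i.2 ω :=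
      funext fun i => (hω i.1 i.2).symm
    rw [this]
    rfl
  rw [heq]
  have hmain := h n k₀ Ω P b' hb' (fun k c => (hb.hasLaw k c).aemeasurable.measurable_mk) (n - k₀)
    (by omega)
  rw [Nat.add_sub_cancel' hkn] at hmain
  refine le_trans ?_ hmain
  obtain ⟨h1, h2⟩ := MBRW.sqrt_log_two_bounds
  have hn' : (1 : ℝ) ≤ n := by exact_mod_cast hn
  have hL : ((n - k₀ + 1 : ℕ) : ℝ) = n - k₀ + 1 := by push_cast [Nat.cast_sub hkn]; ring
  have hL0 : ((n - k₀ + 1 : ℕ) : ℝ) ≠ 0 := by positivity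
  have hlog : Real.log (n - k₀ + 1 : ℕ) ≤ Real.log n + 1 := by
    have h3 : ((n - k₀ + 1 : ℕ) : ℝ) ≤ 2 * n := by
      rw [hL]; have : (0 : ℝ) ≤ k₀ := Nat.cast_nonneg _
      linarith
    have h4 := Real.log_le_log (by positivity) h3
    rw [Real.log_mul (by norm_num) (by linarith)] at h4
    have := Real.log_two_lt_d9
    linarith
  have hc : 3 / (4 * √(Real.log 2)) ≤ 1 := by
    rw [div_le_one (by linarith)]; linarith
  have hc0 : 0 ≤ 3 / (4 * √(Real.log 2)) := by positivity
  have e : ((n - k₀ + 1 : ℕ) : ℝ) * MBRW.slope (n - k₀ + 1) =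
      2 * √(Real.log 2) * (n - k₀ + 1) -
        3 / (4 * √(Real.log 2)) * Real.log (n - k₀ + 1 : ℕ) := by
    rw [← hL]
    unfold MBRW.slope
    field_simp
  rw [e]
  have h5 := mul_le_mul_of_nonneg_left hlog hc0
  have h6 : √(Real.log 2) * k₀ ≤ 1 * k₀ := mul_le_mul_of_nonneg_right h2 (Nat.cast_nonneg _)
  nlinarith
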